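/- **The calculus $F_{<:A}$.** Write $\mathsf{sync}=\bot$ and $\mathsf{async}=\top$ for the elements of the two-point lattice of *colours* $C$. Let $Y$, $X$, $x$ range over qualifier, type and term variables. The syntax (up to renaming of bound variables) is - qualifiers $P,Q,R,B ::= Y \mid \mathsf{sync}\mid \mathsf{async}\mid Q\wedge R\mid Q\vee R$; - simple types $S,U ::= \top \mid X\mid T_1\to T_2\mid \forall(X<:S).T\mid \forall(Y<:Q).T$, and qualified types $T ::= \{Q\}\,S$; - values $v ::= \lambda(x)_P.t\mid \Lambda(X<:S)_P.t\mid\Lambda(Y<:Q)_P.t$ (the qualifier $P$ is the *tag* of the value, and lies outside the scope of the binder); - terms $s,t ::= x\mid v\mid s(t)\mid s[S]\mid s\{Q\}\mid \mathsf{assert}\,Q\,s\mid\mathsf{upqual}\,Q\,s$; - environments $\Gamma ::= \varnothing\mid\Gamma,x:T\mid \Gamma,X<:S\mid\Gamma,Y<:Q$. All expressions are assumed well scoped. $\mathrm{eval}(Q)$ is the colour obtained by computing the meets and joins in $Q$; it is undefined if a variable occurs in $Q$. *Subqualification* $\Gamma\vdash Q<:R$ is generated by: $Q<:\mathsf{async}$;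 $\mathsf{sync}<:Q$; $Y<:Y$; $Y<:R$ if $(Y<:Q)\in\Gamma$ and $Q<:R$; $Q_1\wedge Q_2<:R$ if $Q_1<:R$ or $Q_2<:R$; $Q<:R_1\wedge R_2$ if $Q<:R_1$ and $Q<:R_2$; $Q<:R_1\vee R_2$ if $Q<:R_1$ or $Q<:R_2$; $Q_1\vee Q_2<:R$ if $Q_1<:R$ and $Q_2<:R$. *Subtyping* is generated by: $\{Q_1\}S_1<:\{Q_2\}S_2$ if $Q_1<:Q_2$ and $S_1<:S_2$; $S<:\top$; $X<:X$; $X<:S$ if $(X<:U)\in\Gamma$ and $U<:S$; $T_1\to T_2<:T_1'\to T_2'$ if $T_1'<:T_1$ and $T_2<:T_2'$; $\Gamma\vdash\forall(X<:U_1).T_1<:\forall(X<:U_2).T_2$ if $\Gamma\vdash U_2<:U_1$ and $\Gamma,X<:U_2\vdash T_1<:T_2$; and likewise for $\forall(Y<:Q).T$. *Typing* $\Gamma\mid R\vdash t:T$, where the qualifier $R$ is the colour context, is generated by: - $\Gamma\mid R\vdash x:T$ if $(x:T)\in\Gamma$; - if $\Gamma,x:T_1\mid P\vdash t:T_2$,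 then $\Gamma\mid R\vdash\lambda(x)_P.t:\{P\}(T_1\to T_2)$; - if $\Gamma,X<:S\mid P\vdash t:T$, then $\Gamma\mid R\vdash\Lambda(X<:S)_P.t:\{P\}\forall(X<:S).T$; and likewise for $\Lambda(Y<:Q)_P.t$; - if $\Gamma\mid R\vdash s:\{R\}(T_1\to T_2)$ and $\Gamma\mid R\vdash t:T_1$, then $\Gamma\mid R\vdash s(t):T_2$; - if $\Gamma\mid R\vdash s:\{R\}\forall(X<:S).T$ and $\Gamma\vdash S'<:S$, then $\Gamma\mid R\vdash s[S']:T[X\mapsto S']$; - if $\Gamma\mid R\vdash s:\{R\}\forall(Y<:Q).T$ and $\Gamma\vdash Q'<:Q$, then $\Gamma\mid R\vdash s\{Q'\}:T[Y\mapsto Q']$; - if $\Gamma\mid R\vdash s:\{Q\}S$, then $\Gamma\mid R\vdash\mathsf{assert}\,Q\,s:\{Q\}S$, and $\Gamma\mid R\vdash\mathsf{upqual}\,Q'\,s:\{Q'\}S$ whenever $\Gamma\vdash Q<:Q'$; - subsumption: if $\Gamma\mid R\vdash t:T$, $\Gamma\vdash T<:T'$ and $\Gamma\vdash R<:R'$,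 then $\Gamma\mid R\vdash t:T'$ and $\Gamma\mid R'\vdash t:T$. **The machine.** A configuration $\langle c,\kappa\rangle$ consists of a closed term $c$ and a continuation $\kappa$, a finite stack (innermost first) of frames $\square(t)$, $v(\square)$, $\square[S]$, $\square\{Q\}$, $\mathsf{assert}\,Q\,\square$, $\mathsf{upqual}\,Q\,\square$ and $\mathsf{barrier}\,C$, all closed. A colour $C$ is *compatible* with $\kappa$ if $C\sqsubseteq D$ for every frame $\mathsf{barrier}\,D$ in $\kappa$. The steps are: - $\langle s(t),\kappa\rangle\to\langle s,\square(t)::\kappa\rangle$, and likewise $s[S]$, $s\{Q\}$, $\mathsf{assert}\,Q\,s$, $\mathsf{upqual}\,Q\,s$ push their frame and continue with $s$; $\langle v,\square(t)::\kappa\rangle\to\langle t,v(\square)::\kappa\rangle$; - calls: if $\mathrm{eval}(P)=C$ and $C$ is compatible with $\kappa$, then $\langle v,(\lambda(x)_P.t)(\square)::\kappa\rangle\to\langle t[x\mapsto v],\mathsf{barrier}\,C::\kappa\rangle$, $\langle\Lambda(X<:U)_P.t,\square[S]::\kappa\rangle\to\langle t[X\mapsto S],\mathsf{barrier}\,C::\kappa\rangle$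 and $\langle\Lambda(Y<:B)_P.t,\square\{Q\}::\kappa\rangle\to\langle t[Y\mapsto Q],\mathsf{barrier}\,C::\kappa\rangle$; - if $v$ has tag $P$ and $\mathrm{eval}(P)\sqsubseteq\mathrm{eval}(Q)$ (both defined), then $\langle v,\mathsf{assert}\,Q\,\square::\kappa\rangle\to\langle v,\kappa\rangle$ and $\langle v,\mathsf{upqual}\,Q\,\square::\kappa\rangle\to\langle v',\kappa\rangle$, where $v'$ is $v$ with its tag replaced by $Q$; - $\langle v,\mathsf{barrier}\,C::\kappa\rangle\to\langle v,\kappa\rangle$. *Continuation typing* $R\vdash\kappa:T\Rightarrow A$ (in the empty environment) is generated by: - $R\vdash[\,]:T\Rightarrow T$; - $R\vdash\square(t)::\kappa:\{R\}(T_1\to T_2)\Rightarrow A$ if $\varnothing\mid R\vdash t:T_1$ and $R\vdash\kappa:T_2\Rightarrow A$; - $R\vdash v(\square)::\kappa:T_1\Rightarrow A$ if $\varnothing\mid R\vdash v:\{R\}(T_1\to T_2)$ and $R\vdash\kappa:T_2\Rightarrow A$; - $R\vdash\square[S']::\kappa:\{R\}\forall(X<:S).T\Rightarrow A$ if $S'<:S$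 and $R\vdash\kappa:T[X\mapsto S']\Rightarrow A$; and likewise for $\square\{Q'\}$; - $R\vdash\mathsf{assert}\,Q\,\square::\kappa:\{Q\}S\Rightarrow A$ if $R\vdash\kappa:\{Q\}S\Rightarrow A$; - $R\vdash\mathsf{upqual}\,Q'\,\square::\kappa:\{Q\}S\Rightarrow A$ if $Q<:Q'$ and $R\vdash\kappa:\{Q'\}S\Rightarrow A$; - $C\vdash\mathsf{barrier}\,C::\kappa:T\Rightarrow A$ if $C<:R$ and $R\vdash\kappa:T\Rightarrow A$; - $R\vdash\kappa:T\Rightarrow A$ if $T<:T'$ and $R\vdash\kappa:T'\Rightarrow A$. A configuration $\langle c,\kappa\rangle$ is *well typed with answer type $A$* if there are $R$ and $T$ with $\varnothing\mid R\vdash c:T$ and $R\vdash\kappa:T\Rightarrow A$; it is *well typed* if this holds for some $A$. **Theorem (Preservation of $F_{<:A}$).** 1. If $\langle c,\kappa\rangle$ is well typed and $\langle c,\kappa\rangle\to\langle c',\kappa'\rangle$, then $\langle c',\kappa'\rangle$ is well typed. 2. More precisely, if $\langle c,\kappa\rangle$ is well typed with answer type $A$, then so is $\langle c',\kappa'\rangle$.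 3. An asynchronous function is never called beneath a synchronous barrier: let $\gamma$ be a well-typed configuration and $\gamma\to^*\gamma'$, where a function with tag $P$ is about to be called in $\gamma'$ on top of the continuation $\kappa$, i.e. $\gamma'$ is $\langle v,(\lambda(x)_P.t)(\square)::\kappa\rangle$, $\langle\Lambda(X<:U)_P.t,\square[S]::\kappa\rangle$ or $\langle\Lambda(Y<:B)_P.t,\square\{Q\}::\kappa\rangle$ (whether or not the machine permits the call). If $\mathrm{eval}(P)=\mathsf{async}$, then $\kappa$ contains no frame $\mathsf{barrier}\;\mathsf{sync}$. -/

import Mathlib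

/-!
The calculus F<:A (System F<: with synchronicity qualifiers) and its CK machine with barriers.

All expressions are intrinsically scoped de Bruijn expressions. There are three separate kinds of
variables: qualifier variables `Y` (`n` of them in scope), simple-type variables `X` (`m` in scope)
and term variables `x` (`k` in scope). An expression over a scope is therefore automatically
well formed in every environment with that scope.
-/

namespace FsubA

/-! ### Qualifiers -/

/-- The two concrete colours. `sync` is the bottom and `async` the top of the two-point lattice. -/
inductive Colour : Type
  | sync
  | async

namespace Colour

/-- The order of the two-point lattice: everything except `async ⊑ sync`. -/
inductive Le : Colour → Colour → Prop
  | sync_le (C : Colour) : Le sync C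
  | le_async (C : Colour) : Le C async

def meet : Colour → Colour → Colour
  | async, C => C
  | sync, _ => sync

def join : Colour → Colour → Colour
  | async, _ => async
  | sync, C => C

end Colour

/-- Qualifier expressions `P, Q, R ::= Y | sync (⊥) | async (⊤) | Q ∧ R | Q ∨ R`. -/
inductive Qual : ℕ → Type
  | var {n : ℕ} (Y : Fin n) : Qual n
  | sync {n : ℕ} : Qual n
  | async {n : ℕ} : Qual n
  | meet {n : ℕ} (Q R : Qual n) : Qual n
  | join {n : ℕ} (Q R : Qual n) : Qual n

def Colour.toQual {n : ℕ} : Colour → Qual n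
  | sync => Qual.sync
  | async => Qual.async

/-- Lifting of a renaming under one binder. -/
def liftRen {n n' : ℕ} (ρ : Fin n → Fin n') : Fin (n + 1) → Fin (n' + 1) :=
  Fin.cases 0 (fun i => (ρ i).succ)

namespace Qual

/-- Evaluation of a qualifier expression to a concrete colour, undefined on variables. -/
def eval {n : ℕ} : Qual n → Option Colour
  | var _ => none
  | sync => some Colour.sync
  | async => some Colour.async
  | meet Q R => do
      let C ← Q.eval
      let D ← R.eval
      return C.meet D
  | join Q R => do
      let C ← Q.eval
      let D ← R.eval
      return C.join D

def rename {n n' : ℕ} (ρ : Fin n → Fin n') : Qual n → Qual n'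
  | var Y => var (ρ Y)
  | sync => sync
  | async => async
  | meet Q R => meet (Q.rename ρ) (R.rename ρ)
  | join Q R => join (Q.rename ρ) (R.rename ρ)

/-- Weakening by one qualifier variable. -/
def shift {n : ℕ} (Q : Qual n) : Qual (n + 1) := Q.rename Fin.succ

def subst {n n' : ℕ} (σ : Fin n → Qual n') : Qual n → Qual n'
  | var Y => σ Y
  | sync => sync
  | async => async
  | meet Q R => meet (Q.subst σ) (R.subst σ)
  | join Q R => join (Q.subst σ) (R.subst σ)

/-- Lifting of a substitution under a qualifier binder. -/
def liftSub {n n' : ℕ} (σ : Fin n → Qual n') : Fin (n + 1) → Qual (n' + 1) :=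
  Fin.cases (var 0) (fun i => (σ i).shift)

/-- The substitution `[Y ↦ Q]` of the last qualifier variable. -/
def single {n : ℕ} (Q : Qual n) : Fin (n + 1) → Qual n := Fin.cases Q var

end Qual

/-! ### Types -/

/-- Simple types `S ::= ⊤ | X | T₁ → T₂ | ∀(X <: S).T | ∀(Y <: Q).T`. The qualified types `T`
below arrows and quantifiers are written out as a qualifier followed by a simple type. -/
inductive STy : ℕ → ℕ → Type
  | top {n m : ℕ} : STy n m
  | var {n m : ℕ} (X : Fin m) : STy n m
  | arrow {n m : ℕ} (Q₁ : Qual n) (S₁ : STy n m) (Q₂ : Qual n) (S₂ : STy n m) : STy n m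
  | all {n m : ℕ} (U : STy n m) (Q : Qual n) (S : STy n (m + 1)) : STy n m
  | qall {n m : ℕ} (B : Qual n) (Q : Qual (n + 1)) (S : STy (n + 1) m) : STy n m

namespace STy

def rename {n n' m m' : ℕ} (ρ : Fin n → Fin n') (ξ : Fin m → Fin m') : STy n m → STy n' m'
  | top => top
  | var X => var (ξ X)
  | arrow Q₁ S₁ Q₂ S₂ =>
      arrow (Q₁.rename ρ) (S₁.rename ρ ξ) (Q₂.rename ρ) (S₂.rename ρ ξ)
  | all U Q S => all (U.rename ρ ξ) (Q.rename ρ) (S.rename ρ (liftRen ξ))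
  | qall B Q S => qall (B.rename ρ) (Q.rename (liftRen ρ)) (S.rename (liftRen ρ) ξ)

/-- Weakening by one type variable. -/
def shiftT {n m : ℕ} (S : STy n m) : STy n (m + 1) := S.rename id Fin.succ

/-- Weakening by one qualifier variable. -/
def shiftQ {n m : ℕ} (S : STy n m) : STy (n + 1) m := S.rename Fin.succ id

/-- Lifting of a type substitution under a type binder. -/
def liftSub {n m m' : ℕ} (τ : Fin m → STy n m') : Fin (m + 1) → STy n (m' + 1) :=
  Fin.cases (var 0) (fun i => (τ i).shiftT)

/-- Simultaneous substitution of qualifiers for qualifier variables and of simple types for type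
variables. -/
def subst {n n' m m' : ℕ} (σ : Fin n → Qual n') (τ : Fin m → STy n' m') : STy n m → STy n' m'
  | top => top
  | var X => τ X
  | arrow Q₁ S₁ Q₂ S₂ =>
      arrow (Q₁.subst σ) (S₁.subst σ τ) (Q₂.subst σ) (S₂.subst σ τ)
  | all U Q S => all (U.subst σ τ) (Q.subst σ) (S.subst σ (liftSub τ))
  | qall B Q S =>
      qall (B.subst σ) (Q.subst (Qual.liftSub σ))
        (S.subst (Qual.liftSub σ) (fun i => (τ i).shiftQ))

/-- The substitution `[X ↦ U]` of the last type variable. -/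
def single {n m : ℕ} (U : STy n m) : Fin (m + 1) → STy n m := Fin.cases U var

/-- `S[X ↦ U]`. -/
def instT {n m : ℕ} (S : STy n (m + 1)) (U : STy n m) : STy n m := S.subst Qual.var (single U)

/-- `S[Y ↦ Q]`. -/
def instQ {n m : ℕ} (S : STy (n + 1) m) (Q : Qual n) : STy n m := S.subst (Qual.single Q) var

end STy

/-- Qualified types `T ::= {Q} S`. -/
structure QTy (n m : ℕ) : Type where
  q : Qual n
  s : STy n m

namespace QTy

def shiftT {n m : ℕ} (T : QTy n m) : QTy n (m + 1) := ⟨T.q, T.s.shiftT⟩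

def shiftQ {n m : ℕ} (T : QTy n m) : QTy (n + 1) m := ⟨T.q.shift, T.s.shiftQ⟩

end QTy

/-! ### Terms -/

/-- Terms
`s, t ::= x | λ(x)_P. t | Λ(X <: S)_P. t | Λ(Y <: Q)_P. t | s(t) | s[S] | s{Q} | assert Q s | upqual Q s`.
Each abstraction carries its qualifier tag `P`, which lives outside the scope of its binder. -/
inductive Tm : ℕ → ℕ → ℕ → Type
  | var {n m k : ℕ} (x : Fin k) : Tm n m k
  | lam {n m k : ℕ} (P : Qual n) (t : Tm n m (k + 1)) : Tm n m k
  | tlam {n m k : ℕ} (P : Qual n) (S : STy n m) (t : Tm n (m + 1) k) : Tm n m k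
  | qlam {n m k : ℕ} (P : Qual n) (Q : Qual n) (t : Tm (n + 1) m k) : Tm n m k
  | app {n m k : ℕ} (s t : Tm n m k) : Tm n m k
  | tapp {n m k : ℕ} (s : Tm n m k) (S : STy n m) : Tm n m k
  | qapp {n m k : ℕ} (s : Tm n m k) (Q : Qual n) : Tm n m k
  | assertQ {n m k : ℕ} (Q : Qual n) (s : Tm n m k) : Tm n m k
  | upqual {n m k : ℕ} (Q : Qual n) (s : Tm n m k) : Tm n m k

namespace Tm

def rename {n n' m m' k k' : ℕ} (ρ : Fin n → Fin n') (ξ : Fin m → Fin m') (ζ : Fin k → Fin k') :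
    Tm n m k → Tm n' m' k'
  | var x => var (ζ x)
  | lam P t => lam (P.rename ρ) (t.rename ρ ξ (liftRen ζ))
  | tlam P S t => tlam (P.rename ρ) (S.rename ρ ξ) (t.rename ρ (liftRen ξ) ζ)
  | qlam P Q t => qlam (P.rename ρ) (Q.rename ρ) (t.rename (liftRen ρ) ξ ζ)
  | app s t => app (s.rename ρ ξ ζ) (t.rename ρ ξ ζ)
  | tapp s S => tapp (s.rename ρ ξ ζ) (S.rename ρ ξ)
  | qapp s Q => qapp (s.rename ρ ξ ζ) (Q.rename ρ)
  | assertQ Q s => assertQ (Q.rename ρ) (s.rename ρ ξ ζ)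
  | upqual Q s => upqual (Q.rename ρ) (s.rename ρ ξ ζ)

/-- Lifting of a term substitution under a term binder. -/
def liftSub {n m k k' : ℕ} (υ : Fin k → Tm n m k') : Fin (k + 1) → Tm n m (k' + 1) :=
  Fin.cases (var 0) (fun i => (υ i).rename id id Fin.succ)

/-- Simultaneous capture-avoiding substitution for all three kinds of variables. -/
def subst {n n' m m' k k' : ℕ} (σ : Fin n → Qual n') (τ : Fin m → STy n' m')
    (υ : Fin k → Tm n' m' k') : Tm n m k → Tm n' m' k'
  | var x => υ x
  | lam P t => lam (P.subst σ) (t.subst σ τ (liftSub υ))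
  | tlam P S t =>
      tlam (P.subst σ) (S.subst σ τ)
        (t.subst σ (STy.liftSub τ) (fun i => (υ i).rename id Fin.succ id))
  | qlam P Q t =>
      qlam (P.subst σ) (Q.subst σ)
        (t.subst (Qual.liftSub σ) (fun i => (τ i).shiftQ)
          (fun i => (υ i).rename Fin.succ id id))
  | app s t => app (s.subst σ τ υ) (t.subst σ τ υ)
  | tapp s S => tapp (s.subst σ τ υ) (S.subst σ τ)
  | qapp s Q => qapp (s.subst σ τ υ) (Q.subst σ)
  | assertQ Q s => assertQ (Q.subst σ) (s.subst σ τ υ)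
  | upqual Q s => upqual (Q.subst σ) (s.subst σ τ υ)

/-- `t[x ↦ v]`. -/
def inst {n m k : ℕ} (t : Tm n m (k + 1)) (v : Tm n m k) : Tm n m k :=
  t.subst Qual.var STy.var (Fin.cases v var)

/-- `t[X ↦ S]`. -/
def instT {n m k : ℕ} (t : Tm n (m + 1) k) (S : STy n m) : Tm n m k :=
  t.subst Qual.var (STy.single S) var

/-- `t[Y ↦ Q]`. -/
def instQ {n m k : ℕ} (t : Tm (n + 1) m k) (Q : Qual n) : Tm n m k :=
  t.subst (Qual.single Q) STy.var var

/-- The values are the three kinds of abstractions. -/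
inductive IsValue : {n m k : ℕ} → Tm n m k → Prop
  | lam {n m k : ℕ} (P : Qual n) (t : Tm n m (k + 1)) : IsValue (lam P t)
  | tlam {n m k : ℕ} (P : Qual n) (S : STy n m) (t : Tm n (m + 1) k) : IsValue (tlam P S t)
  | qlam {n m k : ℕ} (P : Qual n) (Q : Qual n) (t : Tm (n + 1) m k) : IsValue (qlam P Q t)

/-- The qualifier tag of a value (`none` on terms that are not values). -/
def tag {n m k : ℕ} : Tm n m k → Option (Qual n)
  | lam P _ => some P
  | tlam P _ _ => some P
  | qlam P _ _ => some P
  | _ => none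

/-- Replacement of the qualifier tag of a value (terms that are not values are unchanged). -/
def retag {n m k : ℕ} (Q : Qual n) : Tm n m k → Tm n m k
  | lam _ t => lam Q t
  | tlam _ S t => tlam Q S t
  | qlam _ B t => qlam Q B t
  | t => t

end Tm

/-! ### Environments -/

/-- Environments `Γ ::= ∅ | Γ, x : T | Γ, X <: S | Γ, Y <: Q`. -/
inductive Env : ℕ → ℕ → ℕ → Type
  | empty : Env 0 0 0
  | term {n m k : ℕ} (Γ : Env n m k) (T : QTy n m) : Env n m (k + 1)
  | type {n m k : ℕ} (Γ : Env n m k) (S : STy n m) : Env n (m + 1) k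
  | qual {n m k : ℕ} (Γ : Env n m k) (Q : Qual n) : Env (n + 1) m k

namespace Env

/-- The bound of a qualifier variable, weakened to the whole environment:
`Y <: Q ∈ Γ` means `Γ.qbound Y = Q`. -/
def qbound : {n m k : ℕ} → Env n m k → Fin n → Qual n
  | _, _, _, empty => fun Y => Y.elim0
  | _, _, _, term Γ _ => Γ.qbound
  | _, _, _, type Γ _ => Γ.qbound
  | _, _, _, qual Γ Q => Fin.cases Q.shift (fun Y => (Γ.qbound Y).shift)

/-- The bound of a type variable, weakened to the whole environment. -/
def tbound : {n m k : ℕ} → Env n m k → Fin m → STy n m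
  | _, _, _, empty => fun X => X.elim0
  | _, _, _, term Γ _ => Γ.tbound
  | _, _, _, type Γ S => Fin.cases S.shiftT (fun X => (Γ.tbound X).shiftT)
  | _, _, _, qual Γ _ => fun X => (Γ.tbound X).shiftQ

/-- The type of a term variable, weakened to the whole environment. -/
def typeOf : {n m k : ℕ} → Env n m k → Fin k → QTy n m
  | _, _, _, empty => fun x => x.elim0
  | _, _, _, term Γ T => Fin.cases T Γ.typeOf
  | _, _, _, type Γ _ => fun x => (Γ.typeOf x).shiftT
  | _, _, _, qual Γ _ => fun x => (Γ.typeOf x).shiftQ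

end Env

/-! ### Subqualification and subtyping -/

/-- Subqualification `Γ ⊢ Q <: R`. -/
inductive SubQual {n m k : ℕ} (Γ : Env n m k) : Qual n → Qual n → Prop
  | top (Q : Qual n) : SubQual Γ Q Qual.async
  | bot (Q : Qual n) : SubQual Γ Qual.sync Q
  | reflVar (Y : Fin n) : SubQual Γ (Qual.var Y) (Qual.var Y)
  | var {Y : Fin n} {R : Qual n} :
      SubQual Γ (Γ.qbound Y) R → SubQual Γ (Qual.var Y) R
  | meetElim₁ {Q₁ Q₂ R : Qual n} : SubQual Γ Q₁ R → SubQual Γ (Qual.meet Q₁ Q₂) R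
  | meetElim₂ {Q₁ Q₂ R : Qual n} : SubQual Γ Q₂ R → SubQual Γ (Qual.meet Q₁ Q₂) R
  | meetIntro {Q R₁ R₂ : Qual n} :
      SubQual Γ Q R₁ → SubQual Γ Q R₂ → SubQual Γ Q (Qual.meet R₁ R₂)
  | joinIntro₁ {Q R₁ R₂ : Qual n} : SubQual Γ Q R₁ → SubQual Γ Q (Qual.join R₁ R₂)
  | joinIntro₂ {Q R₁ R₂ : Qual n} : SubQual Γ Q R₂ → SubQual Γ Q (Qual.join R₁ R₂)
  | joinElim {Q₁ Q₂ R : Qual n} :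
      SubQual Γ Q₁ R → SubQual Γ Q₂ R → SubQual Γ (Qual.join Q₁ Q₂) R

/-- Subtyping `Γ ⊢ S₁ <: S₂` of simple types. Wherever qualified types are compared, both the
qualifiers and the simple types are, as in `QSub`. -/
inductive Sub : {n m k : ℕ} → Env n m k → STy n m → STy n m → Prop
  | top {n m k : ℕ} {Γ : Env n m k} (S : STy n m) : Sub Γ S STy.top
  | reflVar {n m k : ℕ} {Γ : Env n m k} (X : Fin m) : Sub Γ (STy.var X) (STy.var X)
  | var {n m k : ℕ} {Γ : Env n m k} {X : Fin m} {S : STy n m} :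
      Sub Γ (Γ.tbound X) S → Sub Γ (STy.var X) S
  | arrow {n m k : ℕ} {Γ : Env n m k} {Q₁ Q₂ R₁ R₂ : Qual n} {S₁ S₂ U₁ U₂ : STy n m} :
      SubQual Γ R₁ Q₁ → Sub Γ U₁ S₁ → SubQual Γ Q₂ R₂ → Sub Γ S₂ U₂ →
      Sub Γ (STy.arrow Q₁ S₁ Q₂ S₂) (STy.arrow R₁ U₁ R₂ U₂)
  | all {n m k : ℕ} {Γ : Env n m k} {U₁ U₂ : STy n m} {Q₁ Q₂ : Qual n} {S₁ S₂ : STy n (m + 1)} :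
      Sub Γ U₂ U₁ → SubQual (Γ.type U₂) Q₁ Q₂ → Sub (Γ.type U₂) S₁ S₂ →
      Sub Γ (STy.all U₁ Q₁ S₁) (STy.all U₂ Q₂ S₂)
  | qall {n m k : ℕ} {Γ : Env n m k} {B₁ B₂ : Qual n} {Q₁ Q₂ : Qual (n + 1)}
      {S₁ S₂ : STy (n + 1) m} :
      SubQual Γ B₂ B₁ → SubQual (Γ.qual B₂) Q₁ Q₂ → Sub (Γ.qual B₂) S₁ S₂ →
      Sub Γ (STy.qall B₁ Q₁ S₁) (STy.qall B₂ Q₂ S₂)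

/-- Subtyping of qualified types: `Γ ⊢ {Q₁} S₁ <: {Q₂} S₂` iff `Γ ⊢ Q₁ <: Q₂` and `Γ ⊢ S₁ <: S₂`. -/
def QSub {n m k : ℕ} (Γ : Env n m k) (T₁ T₂ : QTy n m) : Prop :=
  SubQual Γ T₁.q T₂.q ∧ Sub Γ T₁.s T₂.s

/-! ### Typing -/

/-- Typing `Γ | R ⊢ t : T`, where `R` is the colour context. -/
inductive HasTy : {n m k : ℕ} → Env n m k → Qual n → Tm n m k → QTy n m → Prop
  | var {n m k : ℕ} {Γ : Env n m k} {R : Qual n} (x : Fin k) :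
      HasTy Γ R (Tm.var x) (Γ.typeOf x)
  | abs {n m k : ℕ} {Γ : Env n m k} {R P Q₁ Q₂ : Qual n} {S₁ S₂ : STy n m}
      {t : Tm n m (k + 1)} :
      HasTy (Γ.term ⟨Q₁, S₁⟩) P t ⟨Q₂, S₂⟩ →
      HasTy Γ R (Tm.lam P t) ⟨P, STy.arrow Q₁ S₁ Q₂ S₂⟩
  | tabs {n m k : ℕ} {Γ : Env n m k} {R P Q : Qual n} {U : STy n m} {S : STy n (m + 1)}
      {t : Tm n (m + 1) k} :
      HasTy (Γ.type U) P t ⟨Q, S⟩ →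
      HasTy Γ R (Tm.tlam P U t) ⟨P, STy.all U Q S⟩
  | qabs {n m k : ℕ} {Γ : Env n m k} {R P B : Qual n} {Q : Qual (n + 1)} {S : STy (n + 1) m}
      {t : Tm (n + 1) m k} :
      HasTy (Γ.qual B) P.shift t ⟨Q, S⟩ →
      HasTy Γ R (Tm.qlam P B t) ⟨P, STy.qall B Q S⟩
  | app {n m k : ℕ} {Γ : Env n m k} {R Q₁ Q₂ : Qual n} {S₁ S₂ : STy n m} {s t : Tm n m k} :
      HasTy Γ R s ⟨R, STy.arrow Q₁ S₁ Q₂ S₂⟩ → HasTy Γ R t ⟨Q₁, S₁⟩ →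
      HasTy Γ R (Tm.app s t) ⟨Q₂, S₂⟩
  | tapp {n m k : ℕ} {Γ : Env n m k} {R Q : Qual n} {U U' : STy n m} {S : STy n (m + 1)}
      {s : Tm n m k} :
      HasTy Γ R s ⟨R, STy.all U Q S⟩ → Sub Γ U' U →
      HasTy Γ R (Tm.tapp s U') ⟨Q, S.instT U'⟩
  | qapp {n m k : ℕ} {Γ : Env n m k} {R B B' : Qual n} {Q : Qual (n + 1)} {S : STy (n + 1) m}
      {s : Tm n m k} :
      HasTy Γ R s ⟨R, STy.qall B Q S⟩ → SubQual Γ B' B →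
      HasTy Γ R (Tm.qapp s B') ⟨Q.subst (Qual.single B'), S.instQ B'⟩
  | assertQ {n m k : ℕ} {Γ : Env n m k} {R Q : Qual n} {S : STy n m} {s : Tm n m k} :
      HasTy Γ R s ⟨Q, S⟩ → HasTy Γ R (Tm.assertQ Q s) ⟨Q, S⟩
  | upqual {n m k : ℕ} {Γ : Env n m k} {R Q Q' : Qual n} {S : STy n m} {s : Tm n m k} :
      HasTy Γ R s ⟨Q, S⟩ → SubQual Γ Q Q' → HasTy Γ R (Tm.upqual Q' s) ⟨Q', S⟩
  | sub {n m k : ℕ} {Γ : Env n m k} {R : Qual n} {T₁ T₂ : QTy n m} {t : Tm n m k} :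
      HasTy Γ R t T₁ → QSub Γ T₁ T₂ → HasTy Γ R t T₂
  | subEff {n m k : ℕ} {Γ : Env n m k} {R₁ R₂ : Qual n} {T : QTy n m} {t : Tm n m k} :
      HasTy Γ R₁ t T → SubQual Γ R₁ R₂ → HasTy Γ R₂ t T

/-! ### The CK machine -/

/-- Stack frames. -/
inductive Frame : Type
  /-- `□(t)`: the function is being evaluated. -/
  | arg (t : Tm 0 0 0)
  /-- `v(□)`: the argument is being evaluated. -/
  | fn (v : Tm 0 0 0)
  /-- `□[S]` -/
  | targ (S : STy 0 0)
  /-- `□{Q}` -/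
  | qarg (Q : Qual 0)
  /-- `assert Q □` -/
  | assertQ (Q : Qual 0)
  /-- `upqual Q □` -/
  | upqual (Q : Qual 0)
  /-- The body of a called function of colour `C` is being evaluated. -/
  | barrier (C : Colour)

/-- Continuations: stacks of frames, the innermost frame first. -/
abbrev Cont : Type := List Frame

/-- Machine configurations `⟨c, κ⟩`. -/
structure Config : Type where
  c : Tm 0 0 0
  κ : Cont

/-- A function of colour `C` may be called on top of `κ`: its colour is below that of every barrier
on the stack, i.e. an asynchronous function needs a stack without synchronous barriers. -/
def Compatible (C : Colour) (κ : Cont) : Prop :=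
  ∀ D : Colour, Frame.barrier D ∈ κ → Colour.Le C D

/-- Machine steps. -/
inductive Step : Config → Config → Prop
  | pushArg (s t : Tm 0 0 0) (κ : Cont) :
      Step ⟨Tm.app s t, κ⟩ ⟨s, Frame.arg t :: κ⟩
  | pushTArg (s : Tm 0 0 0) (S : STy 0 0) (κ : Cont) :
      Step ⟨Tm.tapp s S, κ⟩ ⟨s, Frame.targ S :: κ⟩
  | pushQArg (s : Tm 0 0 0) (Q : Qual 0) (κ : Cont) :
      Step ⟨Tm.qapp s Q, κ⟩ ⟨s, Frame.qarg Q :: κ⟩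
  | pushAssert (Q : Qual 0) (s : Tm 0 0 0) (κ : Cont) :
      Step ⟨Tm.assertQ Q s, κ⟩ ⟨s, Frame.assertQ Q :: κ⟩
  | pushUpqual (Q : Qual 0) (s : Tm 0 0 0) (κ : Cont) :
      Step ⟨Tm.upqual Q s, κ⟩ ⟨s, Frame.upqual Q :: κ⟩
  | evalArg {v : Tm 0 0 0} (t : Tm 0 0 0) (κ : Cont) : v.IsValue →
      Step ⟨v, Frame.arg t :: κ⟩ ⟨t, Frame.fn v :: κ⟩
  | app {v : Tm 0 0 0} {P : Qual 0} {t : Tm 0 0 1} {C : Colour} {κ : Cont} :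
      v.IsValue → P.eval = some C → Compatible C κ →
      Step ⟨v, Frame.fn (Tm.lam P t) :: κ⟩ ⟨t.inst v, Frame.barrier C :: κ⟩
  | tapp {P : Qual 0} {U S : STy 0 0} {t : Tm 0 1 0} {C : Colour} {κ : Cont} :
      P.eval = some C → Compatible C κ →
      Step ⟨Tm.tlam P U t, Frame.targ S :: κ⟩ ⟨t.instT S, Frame.barrier C :: κ⟩
  | qapp {P B Q : Qual 0} {t : Tm 1 0 0} {C : Colour} {κ : Cont} :
      P.eval = some C → Compatible C κ →
      Step ⟨Tm.qlam P B t, Frame.qarg Q :: κ⟩ ⟨t.instQ Q, Frame.barrier C :: κ⟩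
  | assertQ {v : Tm 0 0 0} {P Q : Qual 0} {C D : Colour} {κ : Cont} :
      v.tag = some P → P.eval = some C → Q.eval = some D → Colour.Le C D →
      Step ⟨v, Frame.assertQ Q :: κ⟩ ⟨v, κ⟩
  | upqual {v : Tm 0 0 0} {P Q : Qual 0} {C D : Colour} {κ : Cont} :
      v.tag = some P → P.eval = some C → Q.eval = some D → Colour.Le C D →
      Step ⟨v, Frame.upqual Q :: κ⟩ ⟨v.retag Q, κ⟩
  | popBarrier {v : Tm 0 0 0} (C : Colour) (κ : Cont) : v.IsValue →
      Step ⟨v, Frame.barrier C :: κ⟩ ⟨v, κ⟩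

/-! ### Well-typed configurations -/

/-- `ContTy R T κ A`: the continuation `κ` takes the result, of type `T`, of a computation in
colour context `R` to a final answer of type `A`. -/
inductive ContTy : Qual 0 → QTy 0 0 → Cont → QTy 0 0 → Prop
  | nil (R : Qual 0) (T : QTy 0 0) : ContTy R T [] T
  | arg {R Q₁ Q₂ : Qual 0} {S₁ S₂ : STy 0 0} {t : Tm 0 0 0} {κ : Cont} {A : QTy 0 0} :
      HasTy Env.empty R t ⟨Q₁, S₁⟩ → ContTy R ⟨Q₂, S₂⟩ κ A →
      ContTy R ⟨R, STy.arrow Q₁ S₁ Q₂ S₂⟩ (Frame.arg t :: κ) A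
  | fn {R Q₁ Q₂ : Qual 0} {S₁ S₂ : STy 0 0} {v : Tm 0 0 0} {κ : Cont} {A : QTy 0 0} :
      v.IsValue → HasTy Env.empty R v ⟨R, STy.arrow Q₁ S₁ Q₂ S₂⟩ → ContTy R ⟨Q₂, S₂⟩ κ A →
      ContTy R ⟨Q₁, S₁⟩ (Frame.fn v :: κ) A
  | targ {R Q : Qual 0} {U U' : STy 0 0} {S : STy 0 1} {κ : Cont} {A : QTy 0 0} :
      Sub Env.empty U' U → ContTy R ⟨Q, S.instT U'⟩ κ A →
      ContTy R ⟨R, STy.all U Q S⟩ (Frame.targ U' :: κ) A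
  | qarg {R B B' : Qual 0} {Q : Qual 1} {S : STy 1 0} {κ : Cont} {A : QTy 0 0} :
      SubQual Env.empty B' B → ContTy R ⟨Q.subst (Qual.single B'), S.instQ B'⟩ κ A →
      ContTy R ⟨R, STy.qall B Q S⟩ (Frame.qarg B' :: κ) A
  | assertQ {R Q : Qual 0} {S : STy 0 0} {κ : Cont} {A : QTy 0 0} :
      ContTy R ⟨Q, S⟩ κ A → ContTy R ⟨Q, S⟩ (Frame.assertQ Q :: κ) A
  | upqual {R Q Q' : Qual 0} {S : STy 0 0} {κ : Cont} {A : QTy 0 0} :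
      SubQual Env.empty Q Q' → ContTy R ⟨Q', S⟩ κ A →
      ContTy R ⟨Q, S⟩ (Frame.upqual Q' :: κ) A
  | barrier {C : Colour} {R : Qual 0} {T : QTy 0 0} {κ : Cont} {A : QTy 0 0} :
      SubQual Env.empty C.toQual R → ContTy R T κ A →
      ContTy C.toQual T (Frame.barrier C :: κ) A
  | sub {R : Qual 0} {T₁ T₂ : QTy 0 0} {κ : Cont} {A : QTy 0 0} :
      QSub Env.empty T₁ T₂ → ContTy R T₂ κ A → ContTy R T₁ κ A

/-- A configuration is well typed with answer type `A` if, in the empty environment and for some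
colour context `R` and type `T`, its control has type `T` in context `R` and its continuation
accepts such a computation. -/
def Config.HasAnswer (γ : Config) (A : QTy 0 0) : Prop :=
  ∃ (R : Qual 0) (T : QTy 0 0), HasTy Env.empty R γ.c T ∧ ContTy R T γ.κ A

def Config.WellTyped (γ : Config) : Prop := ∃ A : QTy 0 0, γ.HasAnswer A

/-- `γ.Calls P κ`: in `γ`, a function value with tag `P` (a term, type or qualifier abstraction)
is about to be called on top of the stack `κ`. The call need not be allowed by `Step`. -/
inductive Config.Calls : Config → Qual 0 → Cont → Prop
  | app {v : Tm 0 0 0} (P : Qual 0) (t : Tm 0 0 1) (κ : Cont) : v.IsValue →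
      Calls ⟨v, Frame.fn (Tm.lam P t) :: κ⟩ P κ
  | tapp (P : Qual 0) (U S : STy 0 0) (t : Tm 0 1 0) (κ : Cont) :
      Calls ⟨Tm.tlam P U t, Frame.targ S :: κ⟩ P κ
  | qapp (P B Q : Qual 0) (t : Tm 1 0 0) (κ : Cont) :
      Calls ⟨Tm.qlam P B t, Frame.qarg Q :: κ⟩ P κ

end FsubA

namespace FsubA

/-! ### Renaming and substitution -/

theorem liftRen_comp {n n' n'' : ℕ} (ρ : Fin n → Fin n') (ρ' : Fin n' → Fin n'') :
    liftRen ρ' ∘ liftRen ρ = liftRen (ρ' ∘ ρ) := by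
  funext i; cases i using Fin.cases <;> simp [liftRen]

theorem liftRen_id {n : ℕ} : liftRen (id : Fin n → Fin n) = id := by
  funext i; cases i using Fin.cases <;> simp [liftRen]

theorem liftRen_comp_succ {n n' : ℕ} (ρ : Fin n → Fin n') :
    liftRen ρ ∘ Fin.succ = Fin.succ ∘ ρ := by
  funext i; simp [liftRen]

namespace Qual

theorem rename_rename {n n' n'' : ℕ} (ρ : Fin n → Fin n') (ρ' : Fin n' → Fin n'') (Q : Qual n) :
    (Q.rename ρ).rename ρ' = Q.rename (ρ' ∘ ρ) := by
  induction Q <;> simp_all [rename]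

theorem subst_rename {n n' n'' : ℕ} (ρ : Fin n → Fin n') (σ : Fin n' → Qual n'') (Q : Qual n) :
    (Q.rename ρ).subst σ = Q.subst (σ ∘ ρ) := by
  induction Q <;> simp_all [rename, subst]

theorem rename_subst {n n' n'' : ℕ} (σ : Fin n → Qual n') (ρ : Fin n' → Fin n'') (Q : Qual n) :
    (Q.subst σ).rename ρ = Q.subst (fun i => (σ i).rename ρ) := by
  induction Q <;> simp_all [rename, subst]

theorem subst_subst {n n' n'' : ℕ} (σ : Fin n → Qual n') (σ' : Fin n' → Qual n'') (Q : Qual n) :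
    (Q.subst σ).subst σ' = Q.subst (fun i => (σ i).subst σ') := by
  induction Q <;> simp_all [subst]

theorem subst_var {n : ℕ} (Q : Qual n) : Q.subst var = Q := by
  induction Q <;> simp_all [subst]

theorem rename_id {n : ℕ} (Q : Qual n) : Q.rename id = Q := by
  induction Q <;> simp_all [rename]

theorem shift_rename {n n' : ℕ} (ρ : Fin n → Fin n') (Q : Qual n) :
    Q.shift.rename (liftRen ρ) = (Q.rename ρ).shift := by
  simp [shift, rename_rename, liftRen_comp_succ]

theorem shift_subst {n n' : ℕ} (σ : Fin n → Qual n') (Q : Qual n) :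
    Q.shift.subst (liftSub σ) = (Q.subst σ).shift := by
  simp only [shift, subst_rename, rename_subst]; rfl

theorem shift_subst_single {n : ℕ} (Q B : Qual n) : Q.shift.subst (single B) = Q := by
  rw [shift, subst_rename]; exact subst_var Q

theorem liftSub_comp_liftRen {n n' n'' : ℕ} (ρ : Fin n → Fin n') (σ : Fin n' → Qual n'') :
    liftSub σ ∘ liftRen ρ = liftSub (σ ∘ ρ) := by
  funext i; cases i using Fin.cases <;> simp [liftSub, liftRen]

theorem liftSub_rename {n n' n'' : ℕ} (σ : Fin n → Qual n') (ρ : Fin n' → Fin n'') :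
    (fun i => (liftSub σ i).rename (liftRen ρ)) = liftSub (fun i => (σ i).rename ρ) := by
  funext i; cases i using Fin.cases <;> simp [liftSub, shift_rename, rename]; simp [liftRen]

theorem liftSub_subst {n n' n'' : ℕ} (σ : Fin n → Qual n') (σ' : Fin n' → Qual n'') :
    (fun i => (liftSub σ i).subst (liftSub σ')) = liftSub (fun i => (σ i).subst σ') := by
  funext i
  cases i using Fin.cases
  · simp [liftSub, subst]
  · simpa [liftSub] using shift_subst σ' _

theorem liftSub_var {n : ℕ} : liftSub (var : Fin n → Qual n) = var := by
  funext i; cases i using Fin.cases <;> simp [liftSub, shift, rename]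

theorem subst_single_rename {n n' : ℕ} (ρ : Fin n → Fin n') (Q : Qual (n + 1)) (B : Qual n) :
    (Q.subst (single B)).rename ρ = (Q.rename (liftRen ρ)).subst (single (B.rename ρ)) := by
  rw [rename_subst, subst_rename]
  congr 1; funext i; cases i using Fin.cases <;> simp [single, liftRen, rename]

theorem subst_single_subst {n n' : ℕ} (σ : Fin n → Qual n') (Q : Qual (n + 1)) (B : Qual n) :
    (Q.subst (single B)).subst σ = (Q.subst (liftSub σ)).subst (single (B.subst σ)) := by
  rw [subst_subst, subst_subst]
  congr 1; funext i
  cases i using Fin.cases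
  · simp [single, liftSub, subst]
  · simp [single, liftSub, subst, shift_subst_single]

end Qual

namespace STy

/-- Composition laws for types build on one another through the liftings under binders:
`rename_subst` needs `rename_rename`, and `subst_subst` needs both mixed laws. Types contain no
terms, so the typing lemmas need no analogue for terms. -/
theorem rename_rename {n m n' m' n'' m'' : ℕ} (ρ : Fin n → Fin n') (ξ : Fin m → Fin m')
    (ρ' : Fin n' → Fin n'') (ξ' : Fin m' → Fin m'') (S : STy n m) :
    (S.rename ρ ξ).rename ρ' ξ' = S.rename (ρ' ∘ ρ) (ξ' ∘ ξ) := by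
  induction S generalizing n' m' n'' m'' <;>
    simp_all [rename, Qual.rename_rename, liftRen_comp]

theorem rename_id {n m : ℕ} (S : STy n m) : S.rename id id = S := by
  induction S <;> simp_all [rename, Qual.rename_id, liftRen_id]

theorem shiftT_rename {n m n' m' : ℕ} (ρ : Fin n → Fin n') (ξ : Fin m → Fin m') (S : STy n m) :
    S.shiftT.rename ρ (liftRen ξ) = (S.rename ρ ξ).shiftT := by
  simp only [shiftT, rename_rename, liftRen_comp_succ]; rfl

theorem shiftQ_rename {n m n' m' : ℕ} (ρ : Fin n → Fin n') (ξ : Fin m → Fin m') (S : STy n m) :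
    S.shiftQ.rename (liftRen ρ) ξ = (S.rename ρ ξ).shiftQ := by
  simp only [shiftQ, rename_rename, liftRen_comp_succ]; rfl

theorem liftSub_comp_liftRen {n m m' m'' : ℕ} (ξ : Fin m → Fin m') (τ : Fin m' → STy n m'') :
    liftSub τ ∘ liftRen ξ = liftSub (τ ∘ ξ) := by
  funext i; cases i using Fin.cases <;> simp [liftSub, liftRen]

theorem subst_rename {n m n' m' n'' m'' : ℕ} (ρ : Fin n → Fin n') (ξ : Fin m → Fin m')
    (σ : Fin n' → Qual n'') (τ : Fin m' → STy n'' m'') (S : STy n m) :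
    (S.rename ρ ξ).subst σ τ = S.subst (σ ∘ ρ) (τ ∘ ξ) := by
  induction S generalizing n' m' n'' m'' <;>
    simp_all [rename, subst, Qual.subst_rename, liftSub_comp_liftRen, Qual.liftSub_comp_liftRen]
  rfl

theorem liftSub_rename {n n' m m' m'' : ℕ} (τ : Fin m → STy n m') (ρ : Fin n → Fin n')
    (ξ : Fin m' → Fin m'') :
    (fun i => (liftSub τ i).rename ρ (liftRen ξ)) = liftSub (fun i => (τ i).rename ρ ξ) := by
  funext i
  cases i using Fin.cases
  · simp [liftSub, rename, liftRen]
  · simp [liftSub, shiftT_rename]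

theorem rename_subst {n m n' m' n'' m'' : ℕ} (σ : Fin n → Qual n') (τ : Fin m → STy n' m')
    (ρ : Fin n' → Fin n'') (ξ : Fin m' → Fin m'') (S : STy n m) :
    (S.subst σ τ).rename ρ ξ =
      S.subst (fun i => (σ i).rename ρ) (fun i => (τ i).rename ρ ξ) := by
  induction S generalizing n' m' n'' m'' <;>
    simp_all [rename, subst, Qual.rename_subst, liftSub_rename, Qual.liftSub_rename, shiftQ_rename]

theorem shiftT_subst {n m n' m' : ℕ} (σ : Fin n → Qual n') (τ : Fin m → STy n' m')
    (S : STy n m) : S.shiftT.subst σ (liftSub τ) = (S.subst σ τ).shiftT := by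
  simp only [shiftT, subst_rename, rename_subst, Qual.rename_id]; rfl

theorem shiftQ_subst {n m n' m' : ℕ} (σ : Fin n → Qual n') (τ : Fin m → STy n' m')
    (S : STy n m) :
    S.shiftQ.subst (Qual.liftSub σ) (fun i => (τ i).shiftQ) = (S.subst σ τ).shiftQ := by
  simp only [shiftQ, subst_rename, rename_subst]; rfl

theorem liftSub_subst {n n' m m' m'' : ℕ} (τ : Fin m → STy n m') (σ : Fin n → Qual n')
    (τ' : Fin m' → STy n' m'') :
    (fun i => (liftSub τ i).subst σ (liftSub τ')) = liftSub (fun i => (τ i).subst σ τ') := by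
  funext i
  cases i using Fin.cases
  · simp [liftSub, subst]
  · simpa [liftSub] using shiftT_subst σ τ' _

theorem subst_subst {n m n' m' n'' m'' : ℕ} (σ : Fin n → Qual n') (τ : Fin m → STy n' m')
    (σ' : Fin n' → Qual n'') (τ' : Fin m' → STy n'' m'') (S : STy n m) :
    (S.subst σ τ).subst σ' τ' =
      S.subst (fun i => (σ i).subst σ') (fun i => (τ i).subst σ' τ') := by
  induction S generalizing n' m' n'' m'' <;>
    simp_all [subst, Qual.subst_subst, liftSub_subst, Qual.liftSub_subst, shiftQ_subst]

theorem liftSub_var {n m : ℕ} : liftSub (var : Fin m → STy n m) = var := by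
  funext i; cases i using Fin.cases <;> simp [liftSub, shiftT, rename]

theorem shiftQ_var {n m : ℕ} (X : Fin m) : (var X : STy n m).shiftQ = var X := rfl

theorem subst_var {n m : ℕ} (S : STy n m) : S.subst Qual.var var = S := by
  induction S <;>
    simp_all [subst, Qual.subst_var, liftSub_var, Qual.liftSub_var, shiftQ_var]

theorem shiftT_subst_single {n m : ℕ} (S U : STy n m) :
    S.shiftT.subst Qual.var (single U) = S := by
  rw [shiftT, subst_rename]; exact subst_var S

theorem shiftQ_subst_single {n m : ℕ} (S : STy n m) (B : Qual n) :
    S.shiftQ.subst (Qual.single B) var = S := by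
  rw [shiftQ, subst_rename]; exact subst_var S

theorem instT_rename {n m n' m' : ℕ} (ρ : Fin n → Fin n') (ξ : Fin m → Fin m')
    (S : STy n (m + 1)) (U : STy n m) :
    (S.instT U).rename ρ ξ = (S.rename ρ (liftRen ξ)).instT (U.rename ρ ξ) := by
  rw [instT, instT, rename_subst, subst_rename]
  congr 1; funext i; cases i using Fin.cases <;> simp [single, liftRen, rename]

theorem instQ_rename {n m n' m' : ℕ} (ρ : Fin n → Fin n') (ξ : Fin m → Fin m')
    (S : STy (n + 1) m) (B : Qual n) :
    (S.instQ B).rename ρ ξ = (S.rename (liftRen ρ) ξ).instQ (B.rename ρ) := by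
  rw [instQ, instQ, rename_subst, subst_rename]
  congr 1; funext i; cases i using Fin.cases <;> simp [Qual.single, liftRen, Qual.rename]

/-- The type of a type application is itself an instance of a body. This commutation, with its
qualifier counterpart `instQ_subst`, keeps the application rules stable under substitution. -/
theorem instT_subst {n m n' m' : ℕ} (σ : Fin n → Qual n') (τ : Fin m → STy n' m')
    (S : STy n (m + 1)) (U : STy n m) :
    (S.instT U).subst σ τ = (S.subst σ (liftSub τ)).instT (U.subst σ τ) := by
  rw [instT, instT, subst_subst, subst_subst]
  congr 1 <;> funext i
  · simp [Qual.subst, Qual.subst_var]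
  cases i using Fin.cases
  · simp [single, liftSub, subst]
  · simp [single, liftSub, subst, shiftT_subst_single]

theorem instQ_subst {n m n' m' : ℕ} (σ : Fin n → Qual n') (τ : Fin m → STy n' m')
    (S : STy (n + 1) m) (B : Qual n) :
    (S.instQ B).subst σ τ =
      (S.subst (Qual.liftSub σ) (fun i => (τ i).shiftQ)).instQ (B.subst σ) := by
  rw [instQ, instQ, subst_subst, subst_subst]
  congr 1 <;> funext i
  · cases i using Fin.cases
    · simp [Qual.single, Qual.liftSub, Qual.subst]
    · simp [Qual.single, Qual.liftSub, Qual.subst, Qual.shift_subst_single]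
  · simp [subst, shiftQ_subst_single]

end STy

/-! ### Subqualification -/

namespace SubQual

theorem refl {n m k : ℕ} (Γ : Env n m k) (Q : Qual n) : SubQual Γ Q Q := by
  induction Q with
  | var Y => exact .reflVar Y
  | sync => exact .bot _
  | async => exact .top _
  | meet Q R hQ hR => exact .meetIntro (.meetElim₁ hQ) (.meetElim₂ hR)
  | join Q R hQ hR => exact .joinElim (.joinIntro₁ hQ) (.joinIntro₂ hR)

/-- A derivation with async on the left uses only the rule for async on the right, meet introduction
and join introduction, all of which can be replayed with any left-hand side. `to_sync` is the dual.
-/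
theorem of_async {n m k : ℕ} {Γ : Env n m k} {Q R : Qual n} (h : SubQual Γ Qual.async R) :
    SubQual Γ Q R := by
  generalize hA : Qual.async = A at h
  induction h with
  | top => exact .top _
  | meetIntro _ _ h₁ h₂ => exact .meetIntro (h₁ hA) (h₂ hA)
  | joinIntro₁ _ h => exact .joinIntro₁ (h hA)
  | joinIntro₂ _ h => exact .joinIntro₂ (h hA)
  | _ => cases hA

theorem to_sync {n m k : ℕ} {Γ : Env n m k} {Q R : Qual n} (h : SubQual Γ Q Qual.sync) :
    SubQual Γ Q R := by
  generalize hA : Qual.sync = A at h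
  induction h with
  | bot => exact .bot _
  | var _ h => exact .var (h hA)
  | joinElim _ _ h₁ h₂ => exact .joinElim (h₁ hA) (h₂ hA)
  | meetElim₁ _ h => exact .meetElim₁ (h hA)
  | meetElim₂ _ h => exact .meetElim₂ (h hA)
  | _ => cases hA

theorem meet_inv {n m k : ℕ} {Γ : Env n m k} {Q R₁ R₂ : Qual n}
    (h : SubQual Γ Q (Qual.meet R₁ R₂)) : SubQual Γ Q R₁ ∧ SubQual Γ Q R₂ := by
  generalize hA : Qual.meet R₁ R₂ = A at h
  induction h with
  | bot => exact ⟨.bot _, .bot _⟩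
  | var _ h => exact ⟨.var (h hA).1, .var (h hA).2⟩
  | joinElim _ _ h₁ h₂ => exact ⟨.joinElim (h₁ hA).1 (h₂ hA).1, .joinElim (h₁ hA).2 (h₂ hA).2⟩
  | meetElim₁ _ h => exact ⟨.meetElim₁ (h hA).1, .meetElim₁ (h hA).2⟩
  | meetElim₂ _ h => exact ⟨.meetElim₂ (h hA).1, .meetElim₂ (h hA).2⟩
  | meetIntro h₁ h₂ => cases hA; exact ⟨h₁, h₂⟩
  | _ => cases hA

theorem join_inv {n m k : ℕ} {Γ : Env n m k} {Q₁ Q₂ R : Qual n}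
    (h : SubQual Γ (Qual.join Q₁ Q₂) R) : SubQual Γ Q₁ R ∧ SubQual Γ Q₂ R := by
  generalize hA : Qual.join Q₁ Q₂ = A at h
  induction h with
  | top => exact ⟨.top _, .top _⟩
  | meetIntro _ _ h₁ h₂ =>
    exact ⟨.meetIntro (h₁ hA).1 (h₂ hA).1, .meetIntro (h₁ hA).2 (h₂ hA).2⟩
  | joinIntro₁ _ h => exact ⟨.joinIntro₁ (h hA).1, .joinIntro₁ (h hA).2⟩
  | joinIntro₂ _ h => exact ⟨.joinIntro₂ (h hA).1, .joinIntro₂ (h hA).2⟩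
  | joinElim h₁ h₂ => cases hA; exact ⟨h₁, h₂⟩
  | _ => cases hA

/-- Cut elimination, by structural induction on the middle qualifier. A variable or join in the
middle is pushed through the left rules of the first derivation, a meet through the right rules of
the second. Looking up a bound is a left rule, so a bound never becomes a middle qualifier and the
induction is well founded. -/
theorem trans {n m k : ℕ} {Γ : Env n m k} {P Q R : Qual n}
    (h₁ : SubQual Γ P Q) (h₂ : SubQual Γ Q R) : SubQual Γ P R := by
  induction Q generalizing P R with
  | sync => exact to_sync h₁
  | async => exact of_async h₂
  | var Y =>
    generalize hA : Qual.var Y = A at h₁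
    induction h₁ with
    | bot => exact .bot _
    | reflVar => cases hA; exact h₂
    | var _ h => exact .var (h hA)
    | joinElim _ _ h₁ h₂ => exact .joinElim (h₁ hA) (h₂ hA)
    | meetElim₁ _ h => exact .meetElim₁ (h hA)
    | meetElim₂ _ h => exact .meetElim₂ (h hA)
    | _ => cases hA
  | meet Q₁ Q₂ ih₁ ih₂ =>
    obtain ⟨h₁, h₁'⟩ := meet_inv h₁
    generalize hA : Qual.meet Q₁ Q₂ = A at h₂
    induction h₂ with
    | top => exact .top _
    | meetElim₁ h => cases hA; exact ih₁ h₁ h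
    | meetElim₂ h => cases hA; exact ih₂ h₁' h
    | meetIntro _ _ h₁ h₂ => exact .meetIntro (h₁ hA) (h₂ hA)
    | joinIntro₁ _ h => exact .joinIntro₁ (h hA)
    | joinIntro₂ _ h => exact .joinIntro₂ (h hA)
    | _ => cases hA
  | join Q₁ Q₂ ih₁ ih₂ =>
    obtain ⟨h₂, h₂'⟩ := join_inv h₂
    generalize hA : Qual.join Q₁ Q₂ = A at h₁
    induction h₁ with
    | bot => exact .bot _
    | var _ h => exact .var (h hA)
    | joinElim _ _ h₁ h₂ => exact .joinElim (h₁ hA) (h₂ hA)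
    | meetElim₁ _ h => exact .meetElim₁ (h hA)
    | meetElim₂ _ h => exact .meetElim₂ (h hA)
    | joinIntro₁ h => cases hA; exact ih₁ h h₂
    | joinIntro₂ h => cases hA; exact ih₂ h h₂'
    | _ => cases hA

/-- Substitution into a subqualification; the environments may bind different numbers of type and
term variables. -/
theorem subst {n m k n' m' k' : ℕ} {Γ : Env n m k} {Δ : Env n' m' k'} {σ : Fin n → Qual n'}
    (hσ : ∀ Y, SubQual Δ (σ Y) ((Γ.qbound Y).subst σ)) {Q R : Qual n} (h : SubQual Γ Q R) :
    SubQual Δ (Q.subst σ) (R.subst σ) := by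
  induction h with
  | top => exact .top _
  | bot => exact .bot _
  | reflVar => exact refl _ _
  | var _ h => exact trans (hσ _) h
  | meetElim₁ _ h => exact .meetElim₁ h
  | meetElim₂ _ h => exact .meetElim₂ h
  | meetIntro _ _ h₁ h₂ => exact .meetIntro h₁ h₂
  | joinIntro₁ _ h => exact .joinIntro₁ h
  | joinIntro₂ _ h => exact .joinIntro₂ h
  | joinElim _ _ h₁ h₂ => exact .joinElim h₁ h₂

theorem rename {n m k n' m' k' : ℕ} {Γ : Env n m k} {Δ : Env n' m' k'} {ρ : Fin n → Fin n'}
    (hρ : ∀ Y, Δ.qbound (ρ Y) = (Γ.qbound Y).rename ρ) {Q R : Qual n} (h : SubQual Γ Q R) :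
    SubQual Δ (Q.rename ρ) (R.rename ρ) := by
  have hQ (Q : Qual n) : Q.rename ρ = Q.subst (fun Y => Qual.var (ρ Y)) := by
    rw [← Q.subst_var, Qual.rename_subst, Qual.subst_subst]; rfl
  rw [hQ, hQ]
  refine h.subst fun Y => .var ?_
  rw [← hQ, hρ]
  exact refl _ _

theorem shift {n m k : ℕ} {Γ : Env n m k} (B : Qual n) {Q R : Qual n} (h : SubQual Γ Q R) :
    SubQual (Γ.qual B) Q.shift R.shift :=
  h.rename fun _ => rfl

/-- Subqualification sees only the qualifier bounds, so it passes freely under term and type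
binders. -/
theorem congr_qbound {n m k m' k' : ℕ} {Γ : Env n m k} {Δ : Env n m' k'}
    {Q R : Qual n} (h : SubQual Γ Q R) (hΔ : Δ.qbound = Γ.qbound) : SubQual Δ Q R := by
  have := h.rename (Δ := Δ) (ρ := id) (fun _ => by rw [hΔ, Qual.rename_id]; rfl)
  rwa [Qual.rename_id, Qual.rename_id] at this

end SubQual

/-! ### Subtyping -/

/-- A renaming of qualifier and type variables that preserves the bounds. -/
structure Env.BoundRen {n m k n' m' k' : ℕ} (Γ : Env n m k) (Δ : Env n' m' k')
    (ρ : Fin n → Fin n') (ξ : Fin m → Fin m') : Prop where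
  qbound : ∀ Y, Δ.qbound (ρ Y) = (Γ.qbound Y).rename ρ
  tbound : ∀ X, Δ.tbound (ξ X) = (Γ.tbound X).rename ρ ξ

namespace Env.BoundRen

variable {n m k n' m' k' : ℕ} {Γ : Env n m k} {Δ : Env n' m' k'}
  {ρ : Fin n → Fin n'} {ξ : Fin m → Fin m'}

theorem type (h : BoundRen Γ Δ ρ ξ) (U : STy n m) :
    BoundRen (Γ.type U) (Δ.type (U.rename ρ ξ)) ρ (liftRen ξ) where
  qbound := h.qbound
  tbound X := by
    cases X using Fin.cases
    · exact (STy.shiftT_rename ρ ξ U).symm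
    · exact (congrArg STy.shiftT (h.tbound _)).trans (STy.shiftT_rename ρ ξ _).symm

theorem qual (h : BoundRen Γ Δ ρ ξ) (B : Qual n) :
    BoundRen (Γ.qual B) (Δ.qual (B.rename ρ)) (liftRen ρ) ξ where
  qbound Y := by
    cases Y using Fin.cases
    · exact (Qual.shift_rename ρ B).symm
    · exact (congrArg Qual.shift (h.qbound _)).trans (Qual.shift_rename ρ _).symm
  tbound X := (congrArg STy.shiftQ (h.tbound X)).trans (STy.shiftQ_rename ρ ξ _).symm

end Env.BoundRen

namespace Sub

theorem refl {n m k : ℕ} (Γ : Env n m k) (S : STy n m) : Sub Γ S S := by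
  induction S generalizing k with
  | top => exact .top _
  | var X => exact .reflVar X
  | arrow Q₁ S₁ Q₂ S₂ h₁ h₂ => exact .arrow (.refl _ _) (h₁ _) (.refl _ _) (h₂ _)
  | all U Q S hU hS => exact .all (hU _) (.refl _ _) (hS _)
  | qall B Q S hS => exact .qall (.refl _ _) (.refl _ _) (hS _)

/-- This cannot be derived from substitution as for qualifiers: substitution into subtypings uses
transitivity, whose proof uses the weakenings obtained here. -/
theorem rename {n m k n' m' k' : ℕ} {Γ : Env n m k} {Δ : Env n' m' k'} {ρ : Fin n → Fin n'}
    {ξ : Fin m → Fin m'} {S U : STy n m} (h : Sub Γ S U) (hρ : Γ.BoundRen Δ ρ ξ) :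
    Sub Δ (S.rename ρ ξ) (U.rename ρ ξ) := by
  induction h generalizing n' m' k' with
  | top => exact .top _
  | reflVar => exact .reflVar _
  | var _ h => exact .var (by rw [hρ.tbound]; exact h hρ)
  | arrow h₁ _ h₂ _ ih₁ ih₂ =>
    exact .arrow (h₁.rename hρ.qbound) (ih₁ hρ) (h₂.rename hρ.qbound) (ih₂ hρ)
  | all _ hQ _ ihU ihS =>
    exact .all (ihU hρ) (hQ.rename (hρ.type _).qbound) (ihS (hρ.type _))
  | qall hB hQ _ ihS =>
    exact .qall (hB.rename hρ.qbound) (hQ.rename (hρ.qual _).qbound) (ihS (hρ.qual _))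

theorem shiftT {n m k : ℕ} {Γ : Env n m k} (V : STy n m) {S U : STy n m} (h : Sub Γ S U) :
    Sub (Γ.type V) S.shiftT U.shiftT :=
  h.rename ⟨fun _ => (Qual.rename_id _).symm, fun _ => rfl⟩

theorem shiftQ {n m k : ℕ} {Γ : Env n m k} (B : Qual n) {S U : STy n m} (h : Sub Γ S U) :
    Sub (Γ.qual B) S.shiftQ U.shiftQ :=
  h.rename ⟨fun _ => rfl, fun _ => rfl⟩

end Sub

theorem Sub.weaken {n m k : ℕ} {Γ : Env n m k} (T : QTy n m) {S U : STy n m} (h : Sub Γ S U) :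
    Sub (Γ.term T) S U := by
  have := h.rename (Δ := Γ.term T) (ρ := id) (ξ := id)
    ⟨fun _ => (Qual.rename_id _).symm, fun _ => (STy.rename_id _).symm⟩
  rwa [STy.rename_id, STy.rename_id] at this

/-! ### Narrowing and transitivity of subtyping -/

/-- The measure for transitivity. It ignores qualifiers and the choice of variables, so a bound
keeps its size when it is weakened. -/
def STy.size : {n m : ℕ} → STy n m → ℕ
  | _, _, top => 0
  | _, _, var _ => 0
  | _, _, arrow _ S₁ _ S₂ => S₁.size + S₂.size + 1
  | _, _, all U _ S => U.size + S.size + 1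
  | _, _, qall _ _ S => S.size + 1

theorem STy.size_rename {n m n' m' : ℕ} (ρ : Fin n → Fin n') (ξ : Fin m → Fin m') (S : STy n m) :
    (S.rename ρ ξ).size = S.size := by
  induction S generalizing n' m' <;> simp_all [rename, size]

/-- `Γ.Narrows Δ N`: `Δ` arises from `Γ` by narrowing bounds, where the type bounds that are
narrowed have size at most `N` in `Γ`. -/
structure Env.Narrows {n m k k' : ℕ} (Γ : Env n m k) (Δ : Env n m k') (N : ℕ) : Prop where
  qbound : ∀ Y, SubQual Δ (Qual.var Y) (Γ.qbound Y)
  tbound : ∀ X, Δ.tbound X = Γ.tbound X ∨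
    (Γ.tbound X).size ≤ N ∧ Sub Δ (Δ.tbound X) (Γ.tbound X)

namespace Env.Narrows

variable {n m k k' N : ℕ} {Γ : Env n m k} {Δ : Env n m k'}

/-- Narrowing of qualifier bounds is substitution along the identity: the field `qbound` is exactly
the condition for that. -/
theorem subQual (h : Narrows Γ Δ N) {Q R : Qual n} (hQ : SubQual Γ Q R) : SubQual Δ Q R := by
  have := hQ.subst (Δ := Δ) (σ := Qual.var) (by simpa [Qual.subst_var] using h.qbound)
  simpa [Qual.subst_var] using this

theorem type (h : Narrows Γ Δ N) (U : STy n m) : Narrows (Γ.type U) (Δ.type U) N where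
  qbound Y := (h.qbound Y).congr_qbound (Δ := Δ.type _) rfl
  tbound X := by
    cases X using Fin.cases with
    | zero => exact .inl rfl
    | succ X =>
      refine (h.tbound X).imp (congrArg STy.shiftT) fun h => ⟨?_, h.2.shiftT U⟩
      exact (STy.size_rename _ _ _).trans_le h.1

theorem qual (h : Narrows Γ Δ N) (B : Qual n) : Narrows (Γ.qual B) (Δ.qual B) N where
  qbound Y := by
    cases Y using Fin.cases with
    | zero => exact .var (.refl _ _)
    | succ Y => exact (h.qbound Y).shift B
  tbound X := by
    refine (h.tbound X).imp (congrArg STy.shiftQ) fun h => ⟨?_, h.2.shiftQ B⟩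
    exact (STy.size_rename _ _ _).trans_le h.1

end Env.Narrows

namespace Sub

/-- Transitivity is needed only where a variable with a narrowed bound is looked up, with its old
bound in the middle. Assuming it for middle types of size at most `N` breaks the circle between
narrowing and transitivity. -/
theorem narrow_of_trans {N : ℕ}
    (trans : ∀ {n m k : ℕ} {Γ : Env n m k} {S U V : STy n m},
      U.size ≤ N → Sub Γ S U → Sub Γ U V → Sub Γ S V)
    {n m k k' : ℕ} {Γ : Env n m k} {Δ : Env n m k'} {S U : STy n m} (h : Sub Γ S U)
    (hΔ : Γ.Narrows Δ N) : Sub Δ S U := by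
  induction h generalizing k' with
  | top => exact .top _
  | reflVar => exact .reflVar _
  | var _ h =>
    refine .var ?_
    rcases hΔ.tbound _ with hX | ⟨hN, hX⟩
    · rw [hX]; exact h hΔ
    · exact trans hN hX (h hΔ)
  | arrow h₁ _ h₂ _ ih₁ ih₂ => exact .arrow (hΔ.subQual h₁) (ih₁ hΔ) (hΔ.subQual h₂) (ih₂ hΔ)
  | all _ hQ _ ihU ihS => exact .all (ihU hΔ) ((hΔ.type _).subQual hQ) (ihS (hΔ.type _))
  | qall hB hQ _ ihS =>
    exact .qall (hΔ.subQual hB) ((hΔ.qual _).subQual hQ) (ihS (hΔ.qual _))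

theorem narrows_qual {n m k : ℕ} (Γ : Env n m k) {B B' : Qual n} (h : SubQual Γ B' B) (N : ℕ) :
    (Γ.qual B).Narrows (Γ.qual B') N where
  qbound Y := by
    cases Y using Fin.cases with
    | zero => exact .var (h.shift B')
    | succ Y => exact .var (.refl _ _)
  tbound _ := .inl rfl

theorem narrows_type {n m k N : ℕ} (Γ : Env n m k) {U U' : STy n m} (hN : U.size ≤ N)
    (h : Sub Γ U' U) : (Γ.type U).Narrows (Γ.type U') N where
  qbound Y := .var (.refl _ _)
  tbound X := by
    cases X using Fin.cases with
    | zero => exact .inr ⟨(STy.size_rename _ _ _).trans_le hN, h.shiftT U'⟩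
    | succ X => exact .inl rfl

/-- Strong induction on the size bound, and within it induction on the first derivation, which
handles variables whose bounds may be arbitrarily large. For quantifiers the first comparison of
bodies must move to the smaller bound of the right-hand type; the bound narrowed there is a proper
part of the middle type, so transitivity at its size is already available. -/
theorem trans_of_size_le (N : ℕ) {n m k : ℕ} {Γ : Env n m k} {S U V : STy n m}
    (hN : U.size ≤ N) (h₁ : Sub Γ S U) (h₂ : Sub Γ U V) : Sub Γ S V := by
  induction N using Nat.strong_induction_on generalizing n m k with
  | _ N ih =>
  induction h₁ with
  | top => cases h₂; exact .top _
  | reflVar => exact h₂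
  | var _ h => exact .var (h hN h₂)
  | arrow hQ₁ hS₁ hQ₂ hS₂ =>
    simp only [STy.size] at hN
    cases h₂ with
    | top => exact .top _
    | arrow hR₁ hU₁ hR₂ hU₂ =>
      exact .arrow (hR₁.trans hQ₁) (ih _ (by omega) le_rfl hU₁ hS₁) (hQ₂.trans hR₂)
        (ih _ (by omega) le_rfl hS₂ hU₂)
  | all hU hQ hS =>
    simp only [STy.size] at hN
    cases h₂ with
    | top => exact .top _
    | all hU' hQ' hS' =>
      have hn := narrows_type _ le_rfl hU'
      exact .all (ih _ (by omega) le_rfl hU' hU) ((hn.subQual hQ).trans hQ')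
        (ih _ (by omega) le_rfl (narrow_of_trans (ih _ (by omega)) hS hn) hS')
  | qall hB hQ hS =>
    simp only [STy.size] at hN
    cases h₂ with
    | top => exact .top _
    | qall hB' hQ' hS' =>
      -- No type bound changes, so any size bound would do; 0 is below `N` because the middle type
      -- is a quantifier.
      have hn := narrows_qual _ hB' 0
      exact .qall (hB'.trans hB) ((hn.subQual hQ).trans hQ')
        (ih _ (by omega) le_rfl (narrow_of_trans (ih _ (by omega)) hS hn) hS')

theorem trans {n m k : ℕ} {Γ : Env n m k} {S U V : STy n m} (h₁ : Sub Γ S U) (h₂ : Sub Γ U V) :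
    Sub Γ S V :=
  trans_of_size_le _ le_rfl h₁ h₂

end Sub

/-! ### Substitution in subtyping -/

/-- A substitution of qualifiers and simple types that respects the bounds. -/
structure Env.BoundSub {n m k n' m' k' : ℕ} (Γ : Env n m k) (Δ : Env n' m' k')
    (σ : Fin n → Qual n') (τ : Fin m → STy n' m') : Prop where
  qbound : ∀ Y, SubQual Δ (σ Y) ((Γ.qbound Y).subst σ)
  tbound : ∀ X, Sub Δ (τ X) ((Γ.tbound X).subst σ τ)

namespace Env.BoundSub

variable {n m k n' m' k' : ℕ} {Γ : Env n m k} {Δ : Env n' m' k'}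
  {σ : Fin n → Qual n'} {τ : Fin m → STy n' m'}

theorem type (h : BoundSub Γ Δ σ τ) (U : STy n m) :
    BoundSub (Γ.type U) (Δ.type (U.subst σ τ)) σ (STy.liftSub τ) where
  qbound Y := (h.qbound Y).congr_qbound (Δ := Δ.type _) rfl
  tbound X := by
    cases X using Fin.cases with
    | zero => exact .var (STy.shiftT_subst σ τ U ▸ .refl _ _)
    | succ X =>
      rw [show (Γ.type U).tbound X.succ = (Γ.tbound X).shiftT from rfl, STy.shiftT_subst]
      exact (h.tbound X).shiftT _

theorem qual (h : BoundSub Γ Δ σ τ) (B : Qual n) :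
    BoundSub (Γ.qual B) (Δ.qual (B.subst σ)) (Qual.liftSub σ) (fun X => (τ X).shiftQ) where
  qbound Y := by
    cases Y using Fin.cases with
    | zero => exact .var (Qual.shift_subst σ B ▸ .refl _ _)
    | succ Y =>
      rw [show (Γ.qual B).qbound Y.succ = (Γ.qbound Y).shift from rfl, Qual.shift_subst]
      exact (h.qbound Y).shift _
  tbound X := by
    rw [show (Γ.qual B).tbound X = (Γ.tbound X).shiftQ from rfl, STy.shiftQ_subst]
    exact (h.tbound X).shiftQ _

end Env.BoundSub

/-- The image of a type variable is only a subtype of the substituted bound, so the variable case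
needs transitivity. -/
theorem Sub.subst {n m k n' m' k' : ℕ} {Γ : Env n m k} {Δ : Env n' m' k'}
    {σ : Fin n → Qual n'} {τ : Fin m → STy n' m'} {S U : STy n m} (h : Sub Γ S U)
    (hσ : Γ.BoundSub Δ σ τ) : Sub Δ (S.subst σ τ) (U.subst σ τ) := by
  induction h generalizing n' m' k' with
  | top => exact .top _
  | reflVar => exact .refl _ _
  | var _ h => exact (hσ.tbound _).trans (h hσ)
  | arrow h₁ _ h₂ _ ih₁ ih₂ =>
    exact .arrow (h₁.subst hσ.qbound) (ih₁ hσ) (h₂.subst hσ.qbound) (ih₂ hσ)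
  | all _ hQ _ ihU ihS =>
    exact .all (ihU hσ) (hQ.subst (hσ.type _).qbound) (ihS (hσ.type _))
  | qall hB hQ _ ihS =>
    exact .qall (hB.subst hσ.qbound) (hQ.subst (hσ.qual _).qbound) (ihS (hσ.qual _))

theorem QSub.refl {n m k : ℕ} (Γ : Env n m k) (T : QTy n m) : QSub Γ T T :=
  ⟨.refl _ _, .refl _ _⟩

theorem QSub.trans {n m k : ℕ} {Γ : Env n m k} {T₁ T₂ T₃ : QTy n m} (h₁ : QSub Γ T₁ T₂)
    (h₂ : QSub Γ T₂ T₃) : QSub Γ T₁ T₃ :=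
  ⟨h₁.1.trans h₂.1, h₁.2.trans h₂.2⟩

/-! ### Typing -/

def QTy.rename {n m n' m' : ℕ} (ρ : Fin n → Fin n') (ξ : Fin m → Fin m') (T : QTy n m) :
    QTy n' m' :=
  ⟨T.q.rename ρ, T.s.rename ρ ξ⟩

def QTy.subst {n m n' m' : ℕ} (σ : Fin n → Qual n') (τ : Fin m → STy n' m') (T : QTy n m) :
    QTy n' m' :=
  ⟨T.q.subst σ, T.s.subst σ τ⟩

namespace QTy

variable {n m n' m' : ℕ}

theorem rename_id (T : QTy n m) : T.rename id id = T := by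
  simp [rename, Qual.rename_id, STy.rename_id]

theorem subst_var (T : QTy n m) : T.subst Qual.var STy.var = T := by
  simp [subst, Qual.subst_var, STy.subst_var]

theorem shiftT_rename (ρ : Fin n → Fin n') (ξ : Fin m → Fin m') (T : QTy n m) :
    T.shiftT.rename ρ (liftRen ξ) = (T.rename ρ ξ).shiftT := by
  simp [rename, shiftT, STy.shiftT_rename]

theorem shiftQ_rename (ρ : Fin n → Fin n') (ξ : Fin m → Fin m') (T : QTy n m) :
    T.shiftQ.rename (liftRen ρ) ξ = (T.rename ρ ξ).shiftQ := by
  simp [rename, shiftQ, STy.shiftQ_rename, Qual.shift_rename]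

theorem shiftT_subst (σ : Fin n → Qual n') (τ : Fin m → STy n' m') (T : QTy n m) :
    T.shiftT.subst σ (STy.liftSub τ) = (T.subst σ τ).shiftT := by
  simp [subst, shiftT, STy.shiftT_subst]

theorem shiftQ_subst (σ : Fin n → Qual n') (τ : Fin m → STy n' m') (T : QTy n m) :
    T.shiftQ.subst (Qual.liftSub σ) (fun X => (τ X).shiftQ) = (T.subst σ τ).shiftQ := by
  simp [subst, shiftQ, STy.shiftQ_subst, Qual.shift_subst]

theorem shiftT_subst_single (T : QTy n m) (U : STy n m) :
    T.shiftT.subst Qual.var (STy.single U) = T := by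
  simp [subst, shiftT, STy.shiftT_subst_single, Qual.subst_var]

theorem shiftQ_subst_single (T : QTy n m) (B : Qual n) :
    T.shiftQ.subst (Qual.single B) STy.var = T := by
  simp [subst, shiftQ, STy.shiftQ_subst_single, Qual.shift_subst_single]

end QTy

/-! ### Renaming and substitution in typing derivations -/

/-- A renaming of all variables that preserves the environment. -/
structure Env.Ren {n m k n' m' k' : ℕ} (Γ : Env n m k) (Δ : Env n' m' k')
    (ρ : Fin n → Fin n') (ξ : Fin m → Fin m') (ζ : Fin k → Fin k') : Prop
    extends Γ.BoundRen Δ ρ ξ where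
  typeOf : ∀ x, Δ.typeOf (ζ x) = (Γ.typeOf x).rename ρ ξ

namespace Env.Ren

variable {n m k n' m' k' : ℕ} {Γ : Env n m k} {Δ : Env n' m' k'}
  {ρ : Fin n → Fin n'} {ξ : Fin m → Fin m'} {ζ : Fin k → Fin k'}

theorem term (h : Ren Γ Δ ρ ξ ζ) (T : QTy n m) :
    Ren (Γ.term T) (Δ.term (T.rename ρ ξ)) ρ ξ (liftRen ζ) where
  qbound := h.qbound
  tbound := h.tbound
  typeOf x := by
    cases x using Fin.cases
    · rfl
    · exact h.typeOf _

theorem type (h : Ren Γ Δ ρ ξ ζ) (U : STy n m) :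
    Ren (Γ.type U) (Δ.type (U.rename ρ ξ)) ρ (liftRen ξ) ζ where
  toBoundRen := h.toBoundRen.type U
  typeOf x := (congrArg QTy.shiftT (h.typeOf x)).trans (QTy.shiftT_rename ρ ξ _).symm

theorem qual (h : Ren Γ Δ ρ ξ ζ) (B : Qual n) :
    Ren (Γ.qual B) (Δ.qual (B.rename ρ)) (liftRen ρ) ξ ζ where
  toBoundRen := h.toBoundRen.qual B
  typeOf x := (congrArg QTy.shiftQ (h.typeOf x)).trans (QTy.shiftQ_rename ρ ξ _).symm

end Env.Ren

namespace HasTy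

theorem rename {n m k n' m' k' : ℕ} {Γ : Env n m k} {Δ : Env n' m' k'} {ρ : Fin n → Fin n'}
    {ξ : Fin m → Fin m'} {ζ : Fin k → Fin k'} {R : Qual n} {t : Tm n m k} {T : QTy n m}
    (h : HasTy Γ R t T) (hρ : Γ.Ren Δ ρ ξ ζ) :
    HasTy Δ (R.rename ρ) (t.rename ρ ξ ζ) (T.rename ρ ξ) := by
  induction h generalizing n' m' k' with
  | var x => rw [← hρ.typeOf]; exact .var _
  | abs _ ih => exact .abs (ih (hρ.term _))
  | tabs _ ih => exact .tabs (ih (hρ.type _))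
  | qabs _ ih => exact .qabs (Qual.shift_rename ρ _ ▸ ih (hρ.qual _))
  | app _ _ ihs iht => exact .app (ihs hρ) (iht hρ)
  | tapp _ hU ih =>
    simp only [QTy.rename, STy.instT_rename]
    exact .tapp (ih hρ) (hU.rename hρ.toBoundRen)
  | qapp _ hB ih =>
    simp only [QTy.rename, STy.instQ_rename, Qual.subst_single_rename]
    exact .qapp (ih hρ) (hB.rename hρ.qbound)
  | assertQ _ ih => exact .assertQ (ih hρ)
  | upqual _ hQ ih => exact .upqual (ih hρ) (hQ.rename hρ.qbound)
  | sub _ hT ih => exact .sub (ih hρ) ⟨hT.1.rename hρ.qbound, hT.2.rename hρ.toBoundRen⟩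
  | subEff _ hR ih => exact .subEff (ih hρ) (hR.rename hρ.qbound)

end HasTy

/-- A substitution for all variables that respects the environment. The terms that are substituted
have to be typed in every colour context, as term variables are; equivalently, in the least one. -/
structure Env.Subst {n m k n' m' k' : ℕ} (Γ : Env n m k) (Δ : Env n' m' k')
    (σ : Fin n → Qual n') (τ : Fin m → STy n' m') (υ : Fin k → Tm n' m' k') : Prop
    extends Γ.BoundSub Δ σ τ where
  typeOf : ∀ x, HasTy Δ Qual.sync (υ x) ((Γ.typeOf x).subst σ τ)

namespace Env.Subst

variable {n m k n' m' k' : ℕ} {Γ : Env n m k} {Δ : Env n' m' k'}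
  {σ : Fin n → Qual n'} {τ : Fin m → STy n' m'} {υ : Fin k → Tm n' m' k'}

theorem term (h : Subst Γ Δ σ τ υ) (T : QTy n m) :
    Subst (Γ.term T) (Δ.term (T.subst σ τ)) σ τ (Tm.liftSub υ) where
  qbound Y := (h.qbound Y).congr_qbound (Δ := Δ.term _) rfl
  tbound X := (h.tbound X).weaken _
  typeOf x := by
    cases x using Fin.cases with
    | zero => exact .var 0
    | succ x =>
      have := (h.typeOf x).rename (Δ := Δ.term (T.subst σ τ)) (ρ := id) (ξ := id) (ζ := Fin.succ)
        ⟨⟨fun _ => (Qual.rename_id _).symm, fun _ => (STy.rename_id _).symm⟩,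
          fun _ => (QTy.rename_id _).symm⟩
      rwa [QTy.rename_id] at this

theorem type (h : Subst Γ Δ σ τ υ) (U : STy n m) :
    Subst (Γ.type U) (Δ.type (U.subst σ τ)) σ (STy.liftSub τ)
      (fun x => (υ x).rename id Fin.succ id) where
  toBoundSub := h.toBoundSub.type U
  typeOf x := by
    have hT (T : QTy n' m') : T.rename id Fin.succ = T.shiftT := by
      simp [QTy.rename, QTy.shiftT, STy.shiftT, Qual.rename_id]
    have := (h.typeOf x).rename (Δ := Δ.type (U.subst σ τ)) (ρ := id) (ξ := Fin.succ) (ζ := id)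
      ⟨⟨fun _ => (Qual.rename_id _).symm, fun _ => rfl⟩, fun _ => (hT _).symm⟩
    rwa [hT, ← QTy.shiftT_subst] at this

theorem qual (h : Subst Γ Δ σ τ υ) (B : Qual n) :
    Subst (Γ.qual B) (Δ.qual (B.subst σ)) (Qual.liftSub σ) (fun X => (τ X).shiftQ)
      (fun x => (υ x).rename Fin.succ id id) where
  toBoundSub := h.toBoundSub.qual B
  typeOf x := by
    have := (h.typeOf x).rename (Δ := Δ.qual (B.subst σ)) (ρ := Fin.succ) (ξ := id) (ζ := id)
      ⟨⟨fun _ => rfl, fun _ => rfl⟩, fun _ => rfl⟩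
    exact QTy.shiftQ_subst σ τ _ ▸ this

end Env.Subst

namespace HasTy

theorem subst {n m k n' m' k' : ℕ} {Γ : Env n m k} {Δ : Env n' m' k'} {σ : Fin n → Qual n'}
    {τ : Fin m → STy n' m'} {υ : Fin k → Tm n' m' k'} {R : Qual n} {t : Tm n m k} {T : QTy n m}
    (h : HasTy Γ R t T) (hσ : Γ.Subst Δ σ τ υ) :
    HasTy Δ (R.subst σ) (t.subst σ τ υ) (T.subst σ τ) := by
  induction h generalizing n' m' k' with
  | var x => exact .subEff (hσ.typeOf x) (.bot _)
  | abs _ ih => exact .abs (ih (hσ.term _))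
  | tabs _ ih => exact .tabs (ih (hσ.type _))
  | qabs _ ih => exact .qabs (Qual.shift_subst σ _ ▸ ih (hσ.qual _))
  | app _ _ ihs iht => exact .app (ihs hσ) (iht hσ)
  | tapp _ hU ih =>
    simp only [QTy.subst, STy.instT_subst]
    exact .tapp (ih hσ) (hU.subst hσ.toBoundSub)
  | qapp _ hB ih =>
    simp only [QTy.subst, STy.instQ_subst, Qual.subst_single_subst]
    exact .qapp (ih hσ) (hB.subst hσ.qbound)
  | assertQ _ ih => exact .assertQ (ih hσ)
  | upqual _ hQ ih => exact .upqual (ih hσ) (hQ.subst hσ.qbound)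
  | sub _ hT ih => exact .sub (ih hσ) ⟨hT.1.subst hσ.qbound, hT.2.subst hσ.toBoundSub⟩
  | subEff _ hR ih => exact .subEff (ih hσ) (hR.subst hσ.qbound)

end HasTy

/-- The substitution `[X ↦ U']` respects the bounds. -/
theorem Env.boundSub_type {n m k : ℕ} (Γ : Env n m k) {U U' : STy n m} (h : Sub Γ U' U) :
    (Γ.type U).BoundSub Γ Qual.var (STy.single U') where
  qbound Y := .var (by rw [Qual.subst_var]; exact .refl _ _)
  tbound X := by
    cases X using Fin.cases with
    | zero => exact (STy.shiftT_subst_single U U').symm ▸ h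
    | succ X => exact .var ((STy.shiftT_subst_single (Γ.tbound X) U').symm ▸ .refl _ _)

/-- The substitution `[Y ↦ B']` respects the bounds. -/
theorem Env.boundSub_qual {n m k : ℕ} (Γ : Env n m k) {B B' : Qual n} (h : SubQual Γ B' B) :
    (Γ.qual B).BoundSub Γ (Qual.single B') STy.var where
  qbound Y := by
    cases Y using Fin.cases with
    | zero => exact (Qual.shift_subst_single B B').symm ▸ h
    | succ Y => exact .var ((Qual.shift_subst_single (Γ.qbound Y) B').symm ▸ .refl _ _)
  tbound X := .var ((STy.shiftQ_subst_single (Γ.tbound X) B').symm ▸ .refl _ _)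

namespace HasTy

variable {n m k : ℕ} {Γ : Env n m k}

/-- Occurrences of the variable may sit in different colour contexts, since each abstraction body is
typed in the context of its own tag. A typing of `v` in the least context serves them all. -/
theorem inst {P : Qual n} {T₁ T₂ : QTy n m} {t : Tm n m (k + 1)} {v : Tm n m k}
    (h : HasTy (Γ.term T₁) P t T₂) (hv : HasTy Γ Qual.sync v T₁) :
    HasTy Γ P (t.inst v) T₂ := by
  have := h.subst (Δ := Γ) (σ := Qual.var) (τ := STy.var) (υ := Fin.cases v Tm.var)
    { qbound := fun Y => .var (by rw [Qual.subst_var]; exact .refl _ _)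
      tbound := fun X => .var (by rw [STy.subst_var]; exact .refl _ _)
      typeOf := fun x => by
        rw [QTy.subst_var]
        cases x using Fin.cases with
        | zero => exact hv
        | succ x => exact .var x }
  rwa [Qual.subst_var, QTy.subst_var] at this

theorem instT {P Q : Qual n} {U U' : STy n m} {S : STy n (m + 1)} {t : Tm n (m + 1) k}
    (h : HasTy (Γ.type U) P t ⟨Q, S⟩) (hU : Sub Γ U' U) :
    HasTy Γ P (t.instT U') ⟨Q, S.instT U'⟩ := by
  have := h.subst (υ := Tm.var)
    ⟨Γ.boundSub_type hU, fun x => (QTy.shiftT_subst_single (Γ.typeOf x) U').symm ▸ .var x⟩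
  simp only [QTy.subst, Qual.subst_var] at this
  exact this

theorem instQ {P B B' : Qual n} {Q : Qual (n + 1)} {S : STy (n + 1) m} {t : Tm (n + 1) m k}
    (h : HasTy (Γ.qual B) P.shift t ⟨Q, S⟩) (hB : SubQual Γ B' B) :
    HasTy Γ P (t.instQ B') ⟨Q.subst (Qual.single B'), S.instQ B'⟩ := by
  have := h.subst (υ := Tm.var)
    ⟨Γ.boundSub_qual hB, fun x => (QTy.shiftQ_subst_single (Γ.typeOf x) B').symm ▸ .var x⟩
  -- The tag lies outside the binder, so the instantiation undoes its shift and the colour context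
  -- stays `P`.
  rwa [Qual.shift_subst_single] at this

/-! ### Inversion of typing -/

/-- Besides the introduction rule only the two subsumption rules can type an abstraction. Subtyping
steps compose by transitivity; steps that raise the context vanish, because the body is checked in
context `P` and not in `R`. -/
theorem lam_inv {R P : Qual n} {t : Tm n m (k + 1)} {T : QTy n m}
    (h : HasTy Γ R (Tm.lam P t) T) :
    ∃ Q₁ S₁ Q₂ S₂, HasTy (Γ.term ⟨Q₁, S₁⟩) P t ⟨Q₂, S₂⟩ ∧
      QSub Γ ⟨P, STy.arrow Q₁ S₁ Q₂ S₂⟩ T := by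
  generalize ht : Tm.lam P t = s at h
  induction h with
  | abs h => cases ht; exact ⟨_, _, _, _, h, .refl _ _⟩
  | sub _ hT ih =>
    obtain ⟨_, _, _, _, h, h'⟩ := ih ht
    exact ⟨_, _, _, _, h, h'.trans hT⟩
  | subEff _ _ ih => exact ih ht
  | _ => cases ht

theorem tlam_inv {R P : Qual n} {U : STy n m} {t : Tm n (m + 1) k} {T : QTy n m}
    (h : HasTy Γ R (Tm.tlam P U t) T) :
    ∃ Q S, HasTy (Γ.type U) P t ⟨Q, S⟩ ∧ QSub Γ ⟨P, STy.all U Q S⟩ T := by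
  generalize ht : Tm.tlam P U t = s at h
  induction h with
  | tabs h => cases ht; exact ⟨_, _, h, .refl _ _⟩
  | sub _ hT ih =>
    obtain ⟨_, _, h, h'⟩ := ih ht
    exact ⟨_, _, h, h'.trans hT⟩
  | subEff _ _ ih => exact ih ht
  | _ => cases ht

theorem qlam_inv {R P B : Qual n} {t : Tm (n + 1) m k} {T : QTy n m}
    (h : HasTy Γ R (Tm.qlam P B t) T) :
    ∃ Q S, HasTy (Γ.qual B) P.shift t ⟨Q, S⟩ ∧ QSub Γ ⟨P, STy.qall B Q S⟩ T := by
  generalize ht : Tm.qlam P B t = s at h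
  induction h with
  | qabs h => cases ht; exact ⟨_, _, h, .refl _ _⟩
  | sub _ hT ih =>
    obtain ⟨_, _, h, h'⟩ := ih ht
    exact ⟨_, _, h, h'.trans hT⟩
  | subEff _ _ ih => exact ih ht
  | _ => cases ht

/-- The typing of a value does not depend on the colour context. -/
theorem value {R R' : Qual n} {v : Tm n m k} {T : QTy n m} (hv : v.IsValue)
    (h : HasTy Γ R v T) : HasTy Γ R' v T := by
  cases hv with
  | lam => obtain ⟨_, _, _, _, h, hT⟩ := h.lam_inv; exact .sub (.abs h) hT
  | tlam => obtain ⟨_, _, h, hT⟩ := h.tlam_inv; exact .sub (.tabs h) hT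
  | qlam => obtain ⟨_, _, h, hT⟩ := h.qlam_inv; exact .sub (.qabs h) hT

/-- Changing the tag also changes the context in which the body is checked. The old tag is below
`Q`, hence below `Q'`, so the body can be raised to the new context. -/
theorem retag {R Q Q' : Qual n} {S : STy n m} {v : Tm n m k} (hv : v.IsValue)
    (h : HasTy Γ R v ⟨Q, S⟩) (hQ : SubQual Γ Q Q') : HasTy Γ R (v.retag Q') ⟨Q', S⟩ := by
  cases hv with
  | lam =>
    obtain ⟨_, _, _, _, h, hP, hS⟩ := h.lam_inv
    exact .sub (.abs (h.subEff ((hP.trans hQ).congr_qbound (Δ := Γ.term _) rfl))) ⟨.refl _ _, hS⟩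
  | tlam =>
    obtain ⟨_, _, h, hP, hS⟩ := h.tlam_inv
    exact .sub (.tabs (h.subEff ((hP.trans hQ).congr_qbound (Δ := Γ.type _) rfl))) ⟨.refl _ _, hS⟩
  | qlam =>
    obtain ⟨_, _, h, hP, hS⟩ := h.qlam_inv
    exact .sub (.qabs (h.subEff ((hP.trans hQ).shift _))) ⟨.refl _ _, hS⟩

/-- The typing content of a call: the first part will justify the new barrier, the second types the
body that is entered. The next two lemmas play the same role for type and qualifier abstractions. -/
theorem lam_arrow_inv {R P Q Q₁ Q₂ : Qual n} {S₁ S₂ : STy n m} {t : Tm n m (k + 1)}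
    (h : HasTy Γ R (Tm.lam P t) ⟨Q, STy.arrow Q₁ S₁ Q₂ S₂⟩) :
    SubQual Γ P Q ∧ ∀ v : Tm n m k, v.IsValue → HasTy Γ R v ⟨Q₁, S₁⟩ →
      HasTy Γ P (t.inst v) ⟨Q₂, S₂⟩ := by
  obtain ⟨_, _, _, _, ht, hP, hS⟩ := h.lam_inv
  refine ⟨hP, fun v hv h => ?_⟩
  cases hS with
  | arrow hQ₁ hS₁ hQ₂ hS₂ =>
    -- `h.value hv` retypes the argument in the least context, as `inst` requires.
    exact .sub (ht.inst (.sub (h.value hv) ⟨hQ₁, hS₁⟩)) ⟨hQ₂, hS₂⟩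

theorem tlam_all_inv {R P Q Q' : Qual n} {U V : STy n m} {S : STy n (m + 1)}
    {t : Tm n (m + 1) k} (h : HasTy Γ R (Tm.tlam P V t) ⟨Q, STy.all U Q' S⟩) :
    SubQual Γ P Q ∧ ∀ U' : STy n m, Sub Γ U' U →
      HasTy Γ P (t.instT U') ⟨Q', S.instT U'⟩ := by
  obtain ⟨_, _, ht, hP, hS⟩ := h.tlam_inv
  refine ⟨hP, fun U' hU' => ?_⟩
  cases hS with
  | all hU hQ hS =>
    -- The body of the term was checked under the bound `V`, so it needs `U' <: V` by transitivity;
    -- the body types are compared under the smaller bound `U`, where `U' <: U` suffices.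
    refine .sub (ht.instT (hU'.trans hU)) ⟨?_, hS.subst (Γ.boundSub_type hU')⟩
    simpa only [Qual.subst_var] using hQ.subst (Γ.boundSub_type hU').qbound

theorem qlam_qall_inv {R P Q B C : Qual n} {Q' : Qual (n + 1)} {S : STy (n + 1) m}
    {t : Tm (n + 1) m k} (h : HasTy Γ R (Tm.qlam P C t) ⟨Q, STy.qall B Q' S⟩) :
    SubQual Γ P Q ∧ ∀ B' : Qual n, SubQual Γ B' B →
      HasTy Γ P (t.instQ B') ⟨Q'.subst (Qual.single B'), S.instQ B'⟩ := by
  obtain ⟨_, _, ht, hP, hS⟩ := h.qlam_inv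
  refine ⟨hP, fun B' hB' => ?_⟩
  cases hS with
  | qall hB hQ hS =>
    exact .sub (ht.instQ (hB'.trans hB))
      ⟨hQ.subst (Γ.boundSub_qual hB').qbound, hS.subst (Γ.boundSub_qual hB')⟩

end HasTy

/-! ### Inversion of typing for applications, `assert` and `upqual` -/

namespace HasTy

variable {n m k : ℕ} {Γ : Env n m k} {R : Qual n} {T : QTy n m}

theorem app_inv {s t : Tm n m k} (h : HasTy Γ R (Tm.app s t) T) :
    ∃ Q₁ S₁ Q₂ S₂, HasTy Γ R s ⟨R, STy.arrow Q₁ S₁ Q₂ S₂⟩ ∧ HasTy Γ R t ⟨Q₁, S₁⟩ ∧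
      QSub Γ ⟨Q₂, S₂⟩ T := by
  generalize hu : Tm.app s t = u at h
  induction h with
  | app hs ht => cases hu; exact ⟨_, _, _, _, hs, ht, .refl _ _⟩
  | sub _ hT ih =>
    obtain ⟨_, _, _, _, hs, ht, h⟩ := ih hu
    exact ⟨_, _, _, _, hs, ht, h.trans hT⟩
  | subEff _ hR ih =>
    obtain ⟨_, _, _, _, hs, ht, h⟩ := ih hu
    -- The application rule ties the qualifier of the function to the context, so raising the
    -- context means raising that qualifier as well.
    exact ⟨_, _, _, _, .subEff (.sub hs ⟨hR, .refl _ _⟩) hR, .subEff ht hR, h⟩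
  | _ => cases hu

theorem tapp_inv {s : Tm n m k} {U' : STy n m} (h : HasTy Γ R (Tm.tapp s U') T) :
    ∃ U Q S, HasTy Γ R s ⟨R, STy.all U Q S⟩ ∧ Sub Γ U' U ∧ QSub Γ ⟨Q, S.instT U'⟩ T := by
  generalize hu : Tm.tapp s U' = u at h
  induction h with
  | tapp hs hU => cases hu; exact ⟨_, _, _, hs, hU, .refl _ _⟩
  | sub _ hT ih =>
    obtain ⟨_, _, _, hs, hU, h⟩ := ih hu
    exact ⟨_, _, _, hs, hU, h.trans hT⟩
  | subEff _ hR ih =>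
    obtain ⟨_, _, _, hs, hU, h⟩ := ih hu
    exact ⟨_, _, _, .subEff (.sub hs ⟨hR, .refl _ _⟩) hR, hU, h⟩
  | _ => cases hu

theorem qapp_inv {s : Tm n m k} {B' : Qual n} (h : HasTy Γ R (Tm.qapp s B') T) :
    ∃ B Q S, HasTy Γ R s ⟨R, STy.qall B Q S⟩ ∧ SubQual Γ B' B ∧
      QSub Γ ⟨Q.subst (Qual.single B'), S.instQ B'⟩ T := by
  generalize hu : Tm.qapp s B' = u at h
  induction h with
  | qapp hs hB => cases hu; exact ⟨_, _, _, hs, hB, .refl _ _⟩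
  | sub _ hT ih =>
    obtain ⟨_, _, _, hs, hB, h⟩ := ih hu
    exact ⟨_, _, _, hs, hB, h.trans hT⟩
  | subEff _ hR ih =>
    obtain ⟨_, _, _, hs, hB, h⟩ := ih hu
    exact ⟨_, _, _, .subEff (.sub hs ⟨hR, .refl _ _⟩) hR, hB, h⟩
  | _ => cases hu

theorem assertQ_inv {s : Tm n m k} {Q : Qual n} (h : HasTy Γ R (Tm.assertQ Q s) T) :
    ∃ S, HasTy Γ R s ⟨Q, S⟩ ∧ QSub Γ ⟨Q, S⟩ T := by
  generalize hu : Tm.assertQ Q s = u at h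
  induction h with
  | assertQ hs => cases hu; exact ⟨_, hs, .refl _ _⟩
  | sub _ hT ih =>
    obtain ⟨_, hs, h⟩ := ih hu
    exact ⟨_, hs, h.trans hT⟩
  | subEff _ hR ih =>
    obtain ⟨_, hs, h⟩ := ih hu
    exact ⟨_, .subEff hs hR, h⟩
  | _ => cases hu

theorem upqual_inv {s : Tm n m k} {Q' : Qual n} (h : HasTy Γ R (Tm.upqual Q' s) T) :
    ∃ Q S, HasTy Γ R s ⟨Q, S⟩ ∧ SubQual Γ Q Q' ∧ QSub Γ ⟨Q', S⟩ T := by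
  generalize hu : Tm.upqual Q' s = u at h
  induction h with
  | upqual hs hQ => cases hu; exact ⟨_, _, hs, hQ, .refl _ _⟩
  | sub _ hT ih =>
    obtain ⟨_, _, hs, hQ, h⟩ := ih hu
    exact ⟨_, _, hs, hQ, h.trans hT⟩
  | subEff _ hR ih =>
    obtain ⟨_, _, hs, hQ, h⟩ := ih hu
    exact ⟨_, _, .subEff hs hR, hQ, h⟩
  | _ => cases hu

end HasTy

/-! ### Continuations -/

namespace ContTy

variable {R : Qual 0} {T A : QTy 0 0} {κ : Cont}

/-- A continuation typing ends in the rule of its top frame followed by subsumptions on the input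
type. Those compose into one, and the context `R` is not affected by them. -/
theorem arg_inv {t : Tm 0 0 0} (h : ContTy R T (Frame.arg t :: κ) A) :
    ∃ Q₁ S₁ Q₂ S₂, QSub Env.empty T ⟨R, STy.arrow Q₁ S₁ Q₂ S₂⟩ ∧
      HasTy Env.empty R t ⟨Q₁, S₁⟩ ∧ ContTy R ⟨Q₂, S₂⟩ κ A := by
  generalize hκ : Frame.arg t :: κ = κ' at h
  induction h with
  | arg ht h => cases hκ; exact ⟨_, _, _, _, .refl _ _, ht, h⟩
  | sub hT _ ih =>
    obtain ⟨_, _, _, _, hT', h⟩ := ih hκ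
    exact ⟨_, _, _, _, hT.trans hT', h⟩
  | _ => cases hκ

theorem fn_inv {v : Tm 0 0 0} (h : ContTy R T (Frame.fn v :: κ) A) :
    ∃ Q₁ S₁ Q₂ S₂, QSub Env.empty T ⟨Q₁, S₁⟩ ∧
      HasTy Env.empty R v ⟨R, STy.arrow Q₁ S₁ Q₂ S₂⟩ ∧ ContTy R ⟨Q₂, S₂⟩ κ A := by
  generalize hκ : Frame.fn v :: κ = κ' at h
  induction h with
  | fn _ hv h => cases hκ; exact ⟨_, _, _, _, .refl _ _, hv, h⟩
  | sub hT _ ih =>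
    obtain ⟨_, _, _, _, hT', h⟩ := ih hκ
    exact ⟨_, _, _, _, hT.trans hT', h⟩
  | _ => cases hκ

theorem targ_inv {U' : STy 0 0} (h : ContTy R T (Frame.targ U' :: κ) A) :
    ∃ U Q S, QSub Env.empty T ⟨R, STy.all U Q S⟩ ∧ Sub Env.empty U' U ∧
      ContTy R ⟨Q, S.instT U'⟩ κ A := by
  generalize hκ : Frame.targ U' :: κ = κ' at h
  induction h with
  | targ hU h => cases hκ; exact ⟨_, _, _, .refl _ _, hU, h⟩
  | sub hT _ ih =>
    obtain ⟨_, _, _, hT', h⟩ := ih hκ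
    exact ⟨_, _, _, hT.trans hT', h⟩
  | _ => cases hκ

theorem qarg_inv {B' : Qual 0} (h : ContTy R T (Frame.qarg B' :: κ) A) :
    ∃ B Q S, QSub Env.empty T ⟨R, STy.qall B Q S⟩ ∧ SubQual Env.empty B' B ∧
      ContTy R ⟨Q.subst (Qual.single B'), S.instQ B'⟩ κ A := by
  generalize hκ : Frame.qarg B' :: κ = κ' at h
  induction h with
  | qarg hB h => cases hκ; exact ⟨_, _, _, .refl _ _, hB, h⟩
  | sub hT _ ih =>
    obtain ⟨_, _, _, hT', h⟩ := ih hκ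
    exact ⟨_, _, _, hT.trans hT', h⟩
  | _ => cases hκ

theorem assertQ_inv {Q : Qual 0} (h : ContTy R T (Frame.assertQ Q :: κ) A) :
    ContTy R T κ A := by
  generalize hκ : Frame.assertQ Q :: κ = κ' at h
  induction h with
  | assertQ h => cases hκ; exact h
  | sub hT _ ih => exact .sub hT (ih hκ)
  | _ => cases hκ

theorem upqual_inv {Q' : Qual 0} (h : ContTy R T (Frame.upqual Q' :: κ) A) :
    ∃ Q S, QSub Env.empty T ⟨Q, S⟩ ∧ SubQual Env.empty Q Q' ∧ ContTy R ⟨Q', S⟩ κ A := by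
  generalize hκ : Frame.upqual Q' :: κ = κ' at h
  induction h with
  | upqual hQ h => cases hκ; exact ⟨_, _, .refl _ _, hQ, h⟩
  | sub hT _ ih =>
    obtain ⟨_, _, hT', h⟩ := ih hκ
    exact ⟨_, _, hT.trans hT', h⟩
  | _ => cases hκ

/-- The context beneath the barrier can stay unspecified: what is returned to it is a value, which
is typed in every context. -/
theorem barrier_inv {C : Colour} (h : ContTy R T (Frame.barrier C :: κ) A) :
    ∃ R', ContTy R' T κ A := by
  generalize hκ : Frame.barrier C :: κ = κ' at h
  induction h with
  | barrier _ h => cases hκ; exact ⟨_, h⟩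
  | sub hT _ ih =>
    obtain ⟨R', h⟩ := ih hκ
    exact ⟨R', .sub hT h⟩
  | _ => cases hκ

/-- The colour context of a continuation is below each of its barriers. -/
theorem subQual_of_barrier_mem {D : Colour} (h : ContTy R T κ A) (hD : Frame.barrier D ∈ κ) :
    SubQual Env.empty R D.toQual := by
  induction h with
  | nil => cases hD
  -- This is the only frame that changes the context: its colour is below the context `R` beneath
  -- it, which by induction is below all deeper barriers.
  | barrier hR _ ih =>
    rcases List.mem_cons.1 hD with hD | hD
    · cases hD; exact .refl _ _
    · exact hR.trans (ih hD)
  | sub _ _ ih => exact ih hD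
  | arg _ _ ih | fn _ _ _ ih | targ _ _ ih | qarg _ _ ih | assertQ _ ih | upqual _ _ ih =>
    rcases List.mem_cons.1 hD with hD | hD
    · cases hD
    · exact ih hD

end ContTy

/-! ### Preservation -/

/-- A qualifier that evaluates to a colour is equivalent to it. -/
theorem Qual.subQual_of_eval {n m k : ℕ} (Γ : Env n m k) {Q : Qual n} {C : Colour}
    (h : Q.eval = some C) : SubQual Γ Q C.toQual ∧ SubQual Γ C.toQual Q := by
  induction Q generalizing C with
  | var => cases h
  | sync => cases h; exact ⟨.bot _, .bot _⟩
  | async => cases h; exact ⟨.top _, .top _⟩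
  | meet Q R hQ hR =>
    simp only [eval, Option.bind_eq_bind, Option.bind_eq_some_iff] at h
    obtain ⟨C₁, h₁, C₂, h₂, h⟩ := h
    cases h
    obtain ⟨hQ, hQ'⟩ := hQ h₁
    obtain ⟨hR, hR'⟩ := hR h₂
    -- The meet with sync is sync and the meet with async is the other colour, so the colour of `Q`
    -- alone decides which side determines the result.
    cases C₁
    · exact ⟨.meetElim₁ hQ, .bot _⟩
    · exact ⟨.meetElim₂ hR, .meetIntro hQ'.of_async hR'⟩
  | join Q R hQ hR =>
    simp only [eval, Option.bind_eq_bind, Option.bind_eq_some_iff] at h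
    obtain ⟨C₁, h₁, C₂, h₂, h⟩ := h
    cases h
    obtain ⟨hQ, hQ'⟩ := hQ h₁
    obtain ⟨hR, hR'⟩ := hR h₂
    cases C₁
    · exact ⟨.joinElim hQ.to_sync hR, .joinIntro₂ hR'⟩
    · exact ⟨.top _, .joinIntro₁ hQ'⟩

theorem Tm.isValue_of_tag {n m k : ℕ} {v : Tm n m k} {P : Qual n} (h : v.tag = some P) :
    v.IsValue := by
  cases v with
  | lam => exact .lam _ _
  | tlam => exact .tlam _ _ _
  | qlam => exact .qlam _ _ _
  | _ => cases h

namespace Config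

/-- A called body runs in the colour of its tag, behind a barrier of that colour. -/
theorem hasAnswer_barrier {P R : Qual 0} {C : Colour} {t : Tm 0 0 0} {T A : QTy 0 0} {κ : Cont}
    (hC : P.eval = some C) (hP : SubQual Env.empty P R) (ht : HasTy Env.empty P t T)
    (hκ : ContTy R T κ A) : HasAnswer ⟨t, Frame.barrier C :: κ⟩ A :=
  have h := Qual.subQual_of_eval Env.empty hC
  ⟨C.toQual, T, .subEff ht h.1, .barrier (h.2.trans hP) hκ⟩

/-- The context and the intermediate type are chosen anew at each step, while `A` is carried by the
continuation. When a frame is pushed, the subsumption left over from inverting the control moves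
into the continuation, whose rule `ContTy.sub` absorbs it. -/
theorem HasAnswer.step {γ γ' : Config} {A : QTy 0 0} (h : γ.HasAnswer A) (hs : Step γ γ') :
    γ'.HasAnswer A := by
  obtain ⟨R, T, hc, hκ⟩ := h
  cases hs with
  | pushArg =>
    obtain ⟨_, _, _, _, hs, ht, hT⟩ := hc.app_inv
    exact ⟨R, _, hs, .arg ht (.sub hT hκ)⟩
  | pushTArg =>
    obtain ⟨_, _, _, hs, hU, hT⟩ := hc.tapp_inv
    exact ⟨R, _, hs, .targ hU (.sub hT hκ)⟩
  | pushQArg =>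
    obtain ⟨_, _, _, hs, hB, hT⟩ := hc.qapp_inv
    exact ⟨R, _, hs, .qarg hB (.sub hT hκ)⟩
  | pushAssert =>
    obtain ⟨_, hs, hT⟩ := hc.assertQ_inv
    exact ⟨R, _, hs, .assertQ (.sub hT hκ)⟩
  | pushUpqual =>
    obtain ⟨_, _, hs, hQ, hT⟩ := hc.upqual_inv
    exact ⟨R, _, hs, .upqual hQ (.sub hT hκ)⟩
  | evalArg _ _ hv =>
    obtain ⟨_, _, _, _, hT, ht, hκ⟩ := hκ.arg_inv
    exact ⟨R, _, ht, .fn hv (.sub hc hT) hκ⟩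
  | app hv hC _ =>
    obtain ⟨_, _, _, _, hT, hf, hκ⟩ := hκ.fn_inv
    obtain ⟨hP, hf⟩ := hf.lam_arrow_inv
    exact hasAnswer_barrier hC hP (hf _ hv (.sub hc hT)) hκ
  | tapp hC _ =>
    obtain ⟨_, _, _, hT, hU, hκ⟩ := hκ.targ_inv
    obtain ⟨hP, hf⟩ := (HasTy.sub hc hT).tlam_all_inv
    exact hasAnswer_barrier hC hP (hf _ hU) hκ
  | qapp hC _ =>
    obtain ⟨_, _, _, hT, hB, hκ⟩ := hκ.qarg_inv
    obtain ⟨hP, hf⟩ := (HasTy.sub hc hT).qlam_qall_inv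
    exact hasAnswer_barrier hC hP (hf _ hB) hκ
  | assertQ => exact ⟨R, T, hc, hκ.assertQ_inv⟩
  | upqual hv =>
    obtain ⟨_, _, hT, hQ, hκ⟩ := hκ.upqual_inv
    exact ⟨R, _, (HasTy.sub hc hT).retag (Tm.isValue_of_tag hv) hQ, hκ⟩
  | popBarrier _ _ hv =>
    obtain ⟨R', hκ⟩ := hκ.barrier_inv
    -- The returned value moves from the colour of the barrier to the context of its caller.
    exact ⟨R', T, hc.value hv, hκ⟩

theorem HasAnswer.steps {γ γ' : Config} {A : QTy 0 0} (h : γ.HasAnswer A)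
    (hs : Relation.ReflTransGen Step γ γ') : γ'.HasAnswer A := by
  induction hs with
  | refl => exact h
  | tail _ hs ih => exact ih.step hs

/-- In a well-typed configuration, the tag of a function that is about to be called is below every
barrier on the stack. -/
theorem Calls.subQual_of_barrier_mem {γ : Config} {P : Qual 0} {κ : Cont} {D : Colour}
    (h : γ.Calls P κ) (hγ : γ.WellTyped) (hD : Frame.barrier D ∈ κ) :
    SubQual Env.empty P D.toQual := by
  obtain ⟨A, R, T, hc, hκ⟩ := hγ
  cases h with
  | app =>
    obtain ⟨_, _, _, _, _, hf, hκ⟩ := hκ.fn_inv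
    exact hf.lam_arrow_inv.1.trans (hκ.subQual_of_barrier_mem hD)
  | tapp =>
    obtain ⟨_, _, _, hT, _, hκ⟩ := hκ.targ_inv
    exact (HasTy.sub hc hT).tlam_all_inv.1.trans (hκ.subQual_of_barrier_mem hD)
  | qapp =>
    obtain ⟨_, _, _, hT, _, hκ⟩ := hκ.qarg_inv
    exact (HasTy.sub hc hT).qlam_qall_inv.1.trans (hκ.subQual_of_barrier_mem hD)

end Config

end FsubA

theorem mainTheorem8 :
    (∀ (c c' : FsubA.Tm 0 0 0) (κ κ' : FsubA.Cont),
      FsubA.Config.WellTyped ⟨c, κ⟩ → FsubA.Step ⟨c, κ⟩ ⟨c', κ'⟩ →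
      FsubA.Config.WellTyped ⟨c', κ'⟩) ∧
    (∀ (c c' : FsubA.Tm 0 0 0) (κ κ' : FsubA.Cont) (A : FsubA.QTy 0 0),
      FsubA.Config.HasAnswer ⟨c, κ⟩ A → FsubA.Step ⟨c, κ⟩ ⟨c', κ'⟩ →
      FsubA.Config.HasAnswer ⟨c', κ'⟩ A) ∧
    (∀ (γ γ' : FsubA.Config) (P : FsubA.Qual 0) (κ : FsubA.Cont),
      γ.WellTyped → Relation.ReflTransGen FsubA.Step γ γ' → γ'.Calls P κ →
      P.eval = some FsubA.Colour.async → FsubA.Frame.barrier FsubA.Colour.sync ∉ κ) := by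
  refine ⟨fun c c' κ κ' ⟨A, h⟩ hs => ⟨A, h.step hs⟩, fun c c' κ κ' A h hs => h.step hs,
    fun γ γ' P κ ⟨A, h⟩ hs hc hP hκ => ?_⟩
  -- The typing of the configuration before the call already bounds the tag, so the compatibility
  -- test of the machine plays no part.
  have h₁ := hc.subQual_of_barrier_mem ⟨A, h.steps hs⟩ hκ
  have h₂ : FsubA.SubQual FsubA.Env.empty FsubA.Qual.async FsubA.Qual.sync :=
    (FsubA.Qual.subQual_of_eval FsubA.Env.empty hP).2.trans h₁
  -- No rule of subqualification concludes async <: sync.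
  cases h₂
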